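/- Let $(\mathcal R,\partial)$ be a commutative differential ring (with unit), i.e. $\partial$ is additive and $\partial(fg)=(\partial f)g+f\,\partial g$. Let $\mathcal C=\ker\partial$ be its ring of constants. Let $Q:\mathcal R\to\mathcal R$ be a quasi-integration, i.e. a $\mathcal C$-linear map with $\partial Q\partial=\partial$ and $Q\partial Q=Q$. Put $\mathcal R_J=Q\mathcal R$ and $\mathcal R_T=\ker Q$. All tensor products and symmetric algebras are over $\mathcal C$. **Construction of the algebra.** Let $\mathcal T=\bigoplus_{n\ge0}\mathcal R_T^{\otimes n}$, with empty tensor $1_{\mathcal T}$ and shuffle product $\sqcup\!\sqcup$, and let $\widetilde{\mathcal T}=\bigoplus_{n\ge1}\mathcal R_T^{\otimes n}$. For a pure tensor $f=f_1\otimes\dots\otimes f_n$ write $f_i^j=f_i\otimes\dots\otimes f_j$, with $f_{j+1}^j=1_{\mathcal T}$. Let $\widetilde{\mathcal T}^{\odot2}$ be the quotient of $\widetilde{\mathcal T}\otimes\widetilde{\mathcal T}$ by the $\mathcal C$-span of all $f\otimes g-g\otimes f$, and let $\varepsilon(M)$ denote an isomorphic copy of a module $M$. Define $$\mathcal C_1=\mathrm{Sym}(\varepsilon(\mathcal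 R_J\otimes\mathcal T)),\qquad \mathcal C_2=\mathrm{Sym}(\varepsilon(\widetilde{\mathcal T}^{\odot2}))/J_2,$$ where $J_2$ is the ideal generated by $$\varepsilon((f\sqcup\!\sqcup g)\odot h)-\varepsilon(f\odot(g\sqcup\!\sqcup h))+\sum_{j=0}^{m-1}\Big(\sum_{i=\max(0,1-j)}^{n-1}\varepsilon(f_{i+1}^n\odot g_{j+1}^m)\cdot\varepsilon((f_1^i\sqcup\!\sqcup g_1^j)\odot h)-\sum_{k=\max(0,1-j)}^{l-1}\varepsilon(f\odot(g_1^j\sqcup\!\sqcup h_1^k))\cdot\varepsilon(g_{j+1}^m\odot h_{k+1}^l)\Big)$$ for all $n,m,l\ge1$ and all pure tensors $f\in\mathcal R_T^{\otimes n}$, $g\in\mathcal R_T^{\otimes m}$, $h\in\mathcal R_T^{\otimes l}$. The module $\mathcal C_2\otimes\mathcal T$ is a commutative $\mathcal C$-algebra with the $\mathcal C$-bilinear product determined by $$(c\otimes f)\cdot(d\otimes g)=(c\cdot d)\otimes(f\sqcup\!\sqcup g)+\sum_{i=0}^{n-1}\sum_{j=0}^{m-1}\big(c\cdot d\cdot\varepsilon(f_{i+1}^n\odot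 g_{j+1}^m)\big)\otimes(f_1^i\sqcup\!\sqcup g_1^j)$$ for $c,d\in\mathcal C_2$, $n,m\ge0$ and pure tensors $f\in\mathcal R_T^{\otimes n}$, $g\in\mathcal R_T^{\otimes m}$. Let $\mathrm{IDR}(\mathcal R)=\mathcal R\otimes\mathcal C_1\otimes\mathcal C_2\otimes\mathcal T$ be the tensor product of the commutative $\mathcal C$-algebras $\mathcal R$, $\mathcal C_1$ and $\mathcal C_2\otimes\mathcal T$, and let $\iota:\mathcal R\to\mathrm{IDR}(\mathcal R)$, $\iota(f)=f\otimes1\otimes1\otimes1_{\mathcal T}$, be the canonical $\mathcal C$-algebra homomorphism. **Derivation and integration.** Let $\partial$ and $\int$ be the $\mathcal C$-linear maps on $\mathrm{IDR}(\mathcal R)$ determined, for $f_0\in\mathcal R$, $c=c_1\otimes c_2$ with $c_1\in\mathcal C_1$, $c_2\in\mathcal C_2$, and pure tensors $f\in\mathcal R_T^{\otimes n}$, by $$\partial(f_0\otimes c\otimes f)=\begin{cases}(\partial f_0)\otimes c\otimes f&n=0\\(\partial f_0)\otimes c\otimes f+(f_0f_1)\otimes c\otimes f_2^n&n>0\end{cases}$$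 (for $n=0$ it suffices to take $f=1_{\mathcal T}$) and, recursively in $n$, $$\textstyle\int(f_0\otimes c\otimes 1_{\mathcal T})=(Qf_0)\otimes c\otimes 1_{\mathcal T}-1\otimes(c_1\cdot\varepsilon(Qf_0\otimes1_{\mathcal T}))\otimes c_2\otimes 1_{\mathcal T}+1\otimes c\otimes(f_0-\partial Qf_0)$$ and, for $n>0$, $$\textstyle\int(f_0\otimes c\otimes f)=(Qf_0)\otimes c\otimes f-1\otimes(c_1\cdot\varepsilon((Qf_0)\otimes f))\otimes c_2\otimes1_{\mathcal T}-\int(((Qf_0)f_1)\otimes c\otimes f_2^n)+1\otimes c\otimes((f_0-\partial Qf_0)\otimes f).$$ **Theorem.** The following hold. 1. $(\mathrm{IDR}(\mathcal R),\partial,\int)$ is a commutative integro-differential ring: $\partial$ is a derivation on the commutative ring $\mathrm{IDR}(\mathcal R)$, and $\int$ is linear over the ring of constants $\ker\partial\subseteq\mathrm{IDR}(\mathcal R)$ and satisfies $\partial\int=\mathrm{id}$. (The evaluation $\mathrm{id}-\int\partial$ is not required to be multiplicative.) 2. $\iota$ is an injective differential ring homomorphism, i.e. an injective ring homomorphism with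 $\partial\iota(f)=\iota(\partial f)$ for all $f\in\mathcal R$. 3. For all $n\ge1$, $f_0\in\mathcal R$ and $f_1,\dots,f_n\in\mathcal R_T$, with nested integrals (each $\int$ acts on everything to its right), $$\textstyle\iota(f_0)\cdot\int\iota(f_1)\cdot\int\iota(f_2)\cdots\int\iota(f_n)=f_0\otimes1\otimes1\otimes(f_1\otimes\dots\otimes f_n).$$ -/

import Mathlib

open scoped TensorProduct
noncomputable section
namespace IntDiff
section ListLift
variable {C : Type*} [CommRing C] {M : Type*} [AddCommGroup M] [Module C M]

variable (C) in
/-- The pure tensor `f₁ ⊗ ⋯ ⊗ fₙ` in the tensor algebra, for a list `[f₁, …, fₙ]`;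
the empty list gives the empty tensor. -/
def pureTensor (l : List M) : TensorAlgebra C M := (l.map (TensorAlgebra.ι C)).prod

variable (C) in
/-- A function of lists that is `C`-linear in every entry. -/
structure IsListMultilinear {N : Type*} [AddCommGroup N] [Module C N] (F : List M → N) :
    Prop where
  map_add : ∀ l₁ x y l₂, F (l₁ ++ (x + y) :: l₂) = F (l₁ ++ x :: l₂) + F (l₁ ++ y :: l₂)
  map_smul : ∀ l₁ (c : C) x l₂, F (l₁ ++ (c • x) :: l₂) = c • F (l₁ ++ x :: l₂)

variable {N : Type*} [AddCommGroup N] [Module C N]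

theorem ofFn_update {M : Type*} {n : ℕ} (v : Fin n → M) (i : Fin n) [DecidableEq (Fin n)] (x : M) :
    List.ofFn (Function.update v i x)
      = (List.ofFn v).take i ++ x :: (List.ofFn v).drop (i + 1) := by
  have : List.ofFn (Function.update v i x) = (List.ofFn v).set i x := by
    apply List.ext_getElem
    · simp
    · intro k h₁ h₂
      simp only [List.getElem_ofFn, List.getElem_set, Function.update_apply, Fin.ext_iff,
        eq_comm]
  rw [this, List.set_eq_take_append_cons_drop]
  simp

/-- The linear map on the tensor algebra with prescribed values on pure tensors. -/
def listLift (F : List M → N) (hF : IsListMultilinear C F) : TensorAlgebra C M →ₗ[C] N :=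
  (DirectSum.toModule C ℕ N fun n => PiTensorProduct.lift
    { toFun := fun v : Fin n → M => F (List.ofFn v)
      map_update_add' := by
        intro _ v i x y
        simp only [ofFn_update, hF.map_add]
      map_update_smul' := by
        intro _ v i c x
        simp only [ofFn_update, hF.map_smul] }) ∘ₗ
    (TensorAlgebra.equivDirectSum (R := C) (M := M)).toLinearMap

theorem pureTensor_ofFn {n : ℕ} (v : Fin n → M) :
    pureTensor C (List.ofFn v) = TensorAlgebra.tprod C M n v := by
  rw [TensorAlgebra.tprod_apply, pureTensor, List.map_ofFn]; rfl

theorem listLift_pureTensor (F : List M → N) (hF : IsListMultilinear C F) (l : List M) :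
    listLift F hF (pureTensor C l) = F l := by
  obtain ⟨n, v, rfl⟩ : ∃ n, ∃ v : Fin n → M, l = List.ofFn v :=
    ⟨l.length, l.get, by simp⟩
  rw [pureTensor_ofFn]
  simp only [listLift, LinearMap.comp_apply, AlgEquiv.toLinearMap_apply,
    TensorAlgebra.equivDirectSum_apply, TensorAlgebra.toDirectSum_tensorPower_tprod]
  erw [DirectSum.toModule_lof]
  simp

@[simp] theorem pureTensor_nil : pureTensor C ([] : List M) = 1 := rfl

@[simp] theorem pureTensor_cons (a : M) (l : List M) :
    pureTensor C (a :: l) = TensorAlgebra.ι C a * pureTensor C l := by simp [pureTensor]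

theorem pureTensor_append (l l' : List M) :
    pureTensor C (l ++ l') = pureTensor C l * pureTensor C l' := by simp [pureTensor]

theorem span_pureTensor : Submodule.span C (Set.range (pureTensor C (M := M))) = ⊤ := by
  rw [eq_top_iff]
  intro t _
  induction t using TensorAlgebra.induction with
  | algebraMap r =>
    rw [Algebra.algebraMap_eq_smul_one]
    exact Submodule.smul_mem _ _ (Submodule.subset_span ⟨[], rfl⟩)
  | ι x => exact Submodule.subset_span ⟨[x], by simp⟩
  | add a b ha hb => exact Submodule.add_mem _ (ha trivial) (hb trivial)
  | mul a b ha hb =>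
    have := Submodule.mul_mem_mul (ha trivial) (hb trivial)
    rw [Submodule.span_mul_span] at this
    refine Submodule.span_mono ?_ this
    rintro _ ⟨_, ⟨l, rfl⟩, _, ⟨l', rfl⟩, rfl⟩
    exact ⟨l ++ l', pureTensor_append l l'⟩

theorem hom_ext_pureTensor {F G : TensorAlgebra C M →ₗ[C] N}
    (h : ∀ l, F (pureTensor C l) = G (pureTensor C l)) : F = G := by
  apply LinearMap.ext_on_range span_pureTensor h

theorem isListMultilinear_pureTensor : IsListMultilinear C (pureTensor C (M := M)) where
  map_add := by intros; simp [pureTensor_append, mul_add, add_mul]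
  map_smul := by intros; simp [pureTensor_append]

namespace IsListMultilinear

theorem comp {N' : Type*} [AddCommGroup N'] [Module C N'] {F : List M → N}
    (hF : IsListMultilinear C F) (φ : N →ₗ[C] N') : IsListMultilinear C fun l => φ (F l) where
  map_add := by intros; simp [hF.map_add]
  map_smul := by intros; simp [hF.map_smul]

theorem add {F G : List M → N} (hF : IsListMultilinear C F) (hG : IsListMultilinear C G) :
    IsListMultilinear C fun l => F l + G l where
  map_add := by intros; simp only [hF.map_add, hG.map_add]; abel
  map_smul := by intros; simp only [hF.map_smul, hG.map_smul, smul_add]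

/-- Splitting a list in two at position `i`, and plugging the parts into a function that is
multilinear in both. -/
theorem split {F : List M → List M → N} (h₁ : ∀ l, IsListMultilinear C fun k => F k l)
    (h₂ : ∀ k, IsListMultilinear C (F k)) (i : ℕ) :
    IsListMultilinear C fun l => F (l.take i) (l.drop i) where
  map_add := by
    intro l₁ x y l₂
    rcases Nat.lt_or_ge l₁.length i with h | h
    · obtain ⟨k, rfl⟩ := Nat.exists_eq_add_of_lt h
      simp only [List.take_append, List.drop_append, add_assoc, Nat.add_sub_cancel_left,
        List.take_succ_cons, List.drop_succ_cons]
      rw [List.take_of_length_le (by omega), List.drop_eq_nil_of_le (by omega)]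
      exact (h₁ _).map_add _ _ _ _
    · simp only [List.take_append_of_le_length h, List.drop_append_of_le_length h]
      exact (h₂ _).map_add _ _ _ _
  map_smul := by
    intro l₁ c x l₂
    rcases Nat.lt_or_ge l₁.length i with h | h
    · obtain ⟨k, rfl⟩ := Nat.exists_eq_add_of_lt h
      simp only [List.take_append, List.drop_append, add_assoc, Nat.add_sub_cancel_left,
        List.take_succ_cons, List.drop_succ_cons]
      rw [List.take_of_length_le (by omega), List.drop_eq_nil_of_le (by omega)]
      exact (h₁ _).map_smul _ _ _ _
    · simp only [List.take_append_of_le_length h, List.drop_append_of_le_length h]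
      exact (h₂ _).map_smul _ _ _ _

/-- A sum over the positions of the list. -/
theorem sum_length {F : ℕ → List M → N} (hF : ∀ i, IsListMultilinear C (F i)) :
    IsListMultilinear C fun l => ∑ i ∈ Finset.range l.length, F i l where
  map_add := by
    intros; simp only [List.length_append, List.length_cons, (hF _).map_add,
      Finset.sum_add_distrib]
  map_smul := by
    intros; simp only [List.length_append, List.length_cons, (hF _).map_smul, Finset.smul_sum]

theorem sum {ι : Type*} (s : Finset ι) {F : ι → List M → N}
    (hF : ∀ i, IsListMultilinear C (F i)) : IsListMultilinear C fun l => ∑ i ∈ s, F i l where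
  map_add := by intros; simp only [(hF _).map_add, Finset.sum_add_distrib]
  map_smul := by intros; simp only [(hF _).map_smul, Finset.smul_sum]

end IsListMultilinear

end ListLift

section GeneralizedShuffle
variable (C : Type*) [CommRing C] (M : Type*) [AddCommGroup M] [Module C M]

variable {M} in
/-- The shuffle product of the pure tensors given by two lists. -/
def shuffle : List M → List M → TensorAlgebra C M
  | [], g => pureTensor C g
  | a :: f, [] => pureTensor C (a :: f)
  | a :: f, b :: g =>
      TensorAlgebra.ι C a * shuffle f (b :: g) + TensorAlgebra.ι C b * shuffle (a :: f) g
  termination_by f g => f.length + g.length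

/-- The direct sum of the tensor powers of positive order, as the submodule of the tensor algebra
of all elements whose component of order zero vanishes. -/
abbrev positivePart : Submodule C (TensorAlgebra C M) :=
  LinearMap.ker (TensorAlgebra.algebraMapInv (R := C) (M := M)).toLinearMap

/-- The projection of the tensor algebra onto its positive part; it is the identity on the
positive part, and vanishes on tensors of order zero. -/
def toPositivePart : TensorAlgebra C M →ₗ[C] positivePart C M :=
  LinearMap.codRestrict (positivePart C M)
    (LinearMap.id - Algebra.linearMap C (TensorAlgebra C M) ∘ₗ
      (TensorAlgebra.algebraMapInv (R := C) (M := M)).toLinearMap)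
    (fun t => LinearMap.mem_ker.mpr (by
      simp [(TensorAlgebra.algebraMap_leftInverse (R := C) M) _]))

/-- The symmetric square of a module. -/
abbrev SymmetricSquare : Type _ :=
  (M ⊗[C] M) ⧸ Submodule.span C {x : M ⊗[C] M | ∃ f g : M, x = f ⊗ₜ[C] g - g ⊗ₜ[C] f}

/-- The symmetric algebra on (a copy of) the symmetric square of the positive part. -/
def FreeConstants : Type _ := SymmetricAlgebra C (SymmetricSquare C (positivePart C M))

instance : CommRing (FreeConstants C M) :=
  inferInstanceAs (CommRing (SymmetricAlgebra C (SymmetricSquare C (positivePart C M))))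

instance : Algebra C (FreeConstants C M) :=
  inferInstanceAs (Algebra C (SymmetricAlgebra C (SymmetricSquare C (positivePart C M))))

/-- The inclusion of the symmetric square into its symmetric algebra. -/
def freeConstantsι : SymmetricSquare C (positivePart C M) →ₗ[C] FreeConstants C M :=
  SymmetricAlgebra.ι C (SymmetricSquare C (positivePart C M))

/-- `ε(f ⊙ g)` for `f`, `g` in the positive part of the tensor algebra, as an element of the
symmetric algebra, extended by zero to tensors of order zero. -/
def freeEps : TensorAlgebra C M →ₗ[C] TensorAlgebra C M →ₗ[C] FreeConstants C M :=
  ((TensorProduct.mk C (positivePart C M) (positivePart C M)).compr₂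
    (freeConstantsι C M ∘ₗ Submodule.mkQ _)).compl₁₂ (toPositivePart C M) (toPositivePart C M)

variable {M} in
/-- The relation of constants given by three pure tensors `f`, `g`, `h`.
Here `f.take i` is `f₁ ⊗ ⋯ ⊗ fᵢ` and `f.drop i` is `fᵢ₊₁ ⊗ ⋯ ⊗ fₙ`, and the lower summation bound
`1 - j` is truncated, so it is `max 0 (1 - j)`. -/
def constantRelation (f g h : List M) : FreeConstants C M :=
  freeEps C M (shuffle C f g) (pureTensor C h) - freeEps C M (pureTensor C f) (shuffle C g h) +
    ∑ j ∈ Finset.range g.length,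
      (∑ i ∈ Finset.Ico (1 - j) f.length,
          freeEps C M (pureTensor C (f.drop i)) (pureTensor C (g.drop j)) *
            freeEps C M (shuffle C (f.take i) (g.take j)) (pureTensor C h) -
        ∑ k ∈ Finset.Ico (1 - j) h.length,
          freeEps C M (pureTensor C f) (shuffle C (g.take j) (h.take k)) *
            freeEps C M (pureTensor C (g.drop j)) (pureTensor C (h.drop k)))

/-- The ideal generated by the relations of constants. -/
def constantRelations : Ideal (FreeConstants C M) :=
  Ideal.span {x | ∃ f g h : List M, f ≠ [] ∧ g ≠ [] ∧ h ≠ [] ∧ x = constantRelation C f g h}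

/-- The algebra `𝒞₂` of constants that arise from products of nested integrals. -/
def Constants₂ : Type _ := FreeConstants C M ⧸ constantRelations C M

instance : CommRing (Constants₂ C M) :=
  inferInstanceAs (CommRing (FreeConstants C M ⧸ constantRelations C M))

instance : Algebra C (Constants₂ C M) :=
  inferInstanceAs (Algebra C (FreeConstants C M ⧸ constantRelations C M))

/-- The quotient map onto `𝒞₂`. -/
def toConstants₂ : FreeConstants C M →ₐ[C] Constants₂ C M :=
  Ideal.Quotient.mkₐ C (constantRelations C M)

/-- `ε(f ⊙ g)` as an element of `𝒞₂`. -/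
def eps₂ : TensorAlgebra C M →ₗ[C] TensorAlgebra C M →ₗ[C] Constants₂ C M :=
  (freeEps C M).compr₂ (toConstants₂ C M).toLinearMap

/-- The `C`-module `𝒞₂ ⊗ 𝒯`. It is a type synonym, since its multiplication is
not the one of the tensor product of algebras. -/
def GenShuffle : Type _ := Constants₂ C M ⊗[C] TensorAlgebra C M

namespace GenShuffle

instance : AddCommGroup (GenShuffle C M) :=
  inferInstanceAs (AddCommGroup (Constants₂ C M ⊗[C] TensorAlgebra C M))

instance : Module C (GenShuffle C M) :=
  inferInstanceAs (Module C (Constants₂ C M ⊗[C] TensorAlgebra C M))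

/-- The bilinear map `(c, t) ↦ c ⊗ t`. -/
def mk : Constants₂ C M →ₗ[C] TensorAlgebra C M →ₗ[C] GenShuffle C M :=
  TensorProduct.mk C (Constants₂ C M) (TensorAlgebra C M)

variable {C M}

/-- The element `c ⊗ t` of `𝒞₂ ⊗ 𝒯`. -/
def tmul (c : Constants₂ C M) (t : TensorAlgebra C M) : GenShuffle C M := mk C M c t

variable (C) in
/-- The product `(c ⊗ f) · (d ⊗ g)` for pure tensors `f` and `g`. -/
def mulPure (c : Constants₂ C M) (f : List M) (d : Constants₂ C M) (g : List M) :
    GenShuffle C M :=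
  tmul (c * d) (shuffle C f g) +
    ∑ i ∈ Finset.range f.length, ∑ j ∈ Finset.range g.length,
      tmul (c * d * eps₂ C M (pureTensor C (f.drop i)) (pureTensor C (g.drop j)))
        (shuffle C (f.take i) (g.take j))

/-- The linear map on `𝒞₂ ⊗ 𝒯` with prescribed values on `c ⊗ f` for pure tensors `f`. -/
def lift {N : Type*} [AddCommGroup N] [Module C N] (F : Constants₂ C M → List M → N)
    (hadd : ∀ c c' l, F (c + c') l = F c l + F c' l)
    (hsmul : ∀ (r : C) c l, F (r • c) l = r • F c l)
    (hF : ∀ c, IsListMultilinear C (F c)) : GenShuffle C M →ₗ[C] N :=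
  TensorProduct.lift
    { toFun := fun c => listLift (F c) (hF c)
      map_add' := fun c c' => hom_ext_pureTensor fun l => by
        simp [listLift_pureTensor, hadd]
      map_smul' := fun r c => hom_ext_pureTensor fun l => by
        simp [listLift_pureTensor, hsmul] }

theorem lift_tmul {N : Type*} [AddCommGroup N] [Module C N] (F : Constants₂ C M → List M → N)
    (hadd hsmul hF) (c : Constants₂ C M) (l : List M) :
    lift F hadd hsmul hF (tmul c (pureTensor C l)) = F c l := by
  have : lift F hadd hsmul hF (tmul c (pureTensor C l)) = listLift (F c) (hF c) (pureTensor C l) :=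
    TensorProduct.lift.tmul _ _
  rw [this, listLift_pureTensor]

theorem hom_ext {N : Type*} [AddCommGroup N] [Module C N] {F G : GenShuffle C M →ₗ[C] N}
    (h : ∀ c l, F (tmul c (pureTensor C l)) = G (tmul c (pureTensor C l))) : F = G :=
  TensorProduct.ext <| LinearMap.ext fun c => hom_ext_pureTensor fun l => h c l

end GenShuffle

theorem shuffle_nil_left (g : List M) : shuffle C [] g = pureTensor C g := by rw [shuffle]

theorem shuffle_nil_right (f : List M) : shuffle C f [] = pureTensor C f := by
  cases f <;> rw [shuffle]

theorem shuffle_comm (f g : List M) : shuffle C f g = shuffle C g f := by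
  induction f generalizing g with
  | nil => rw [shuffle_nil_left, shuffle_nil_right]
  | cons a f ihf =>
    induction g with
    | nil => rw [shuffle_nil_left, shuffle_nil_right]
    | cons b g ihg => rw [shuffle, shuffle, ihf, ihg, add_comm]

theorem shuffle_multilinear_left (g : List M) :
    IsListMultilinear C fun f => shuffle C f g where
  map_add l₁ x y l₂ := by
    induction l₁ generalizing g with
    | nil =>
      induction g with
      | nil => simp [shuffle_nil_right, add_mul]
      | cons b g ih =>
        simp only [List.nil_append] at ih ⊢
        simp only [shuffle, ih, map_add, add_mul, mul_add]; abel
    | cons a l ih =>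
      induction g with
      | nil => simpa only [shuffle_nil_right] using isListMultilinear_pureTensor.map_add _ _ _ _
      | cons b g ihg =>
        simp only [List.cons_append] at ihg ⊢
        simp only [shuffle, ih, ihg, mul_add]; abel
  map_smul l₁ c x l₂ := by
    induction l₁ generalizing g with
    | nil =>
      induction g with
      | nil => simp [shuffle_nil_right]
      | cons b g ih =>
        simp only [List.nil_append] at ih ⊢
        simp only [shuffle, ih, map_smul, smul_mul_assoc, mul_smul_comm, smul_add]
    | cons a l ih =>
      induction g with
      | nil => simpa only [shuffle_nil_right] using isListMultilinear_pureTensor.map_smul _ _ _ _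
      | cons b g ihg =>
        simp only [List.cons_append] at ihg ⊢
        simp only [shuffle, ih, ihg, mul_smul_comm, smul_add]

theorem shuffle_multilinear_right (f : List M) : IsListMultilinear C (shuffle C f) := by
  have := shuffle_multilinear_left C M f
  simpa only [shuffle_comm C M _ f] using this

theorem freeEps_comm (s t : TensorAlgebra C M) : freeEps C M s t = freeEps C M t s := by
  simp only [freeEps, LinearMap.compl₁₂_apply, LinearMap.compr₂_apply, LinearMap.comp_apply,
    TensorProduct.mk_apply, Submodule.mkQ_apply]
  congr 1
  rw [Submodule.Quotient.eq]
  exact Submodule.subset_span ⟨_, _, rfl⟩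

theorem freeEps_one (t : TensorAlgebra C M) : freeEps C M 1 t = 0 := by
  have : toPositivePart C M 1 = 0 := by
    apply Subtype.ext
    rw [toPositivePart, LinearMap.codRestrict_apply]
    simp
  simp [freeEps, this]

theorem eps₂_comm (s t : TensorAlgebra C M) : eps₂ C M s t = eps₂ C M t s := by
  simp only [eps₂, LinearMap.compr₂_apply, freeEps_comm C M s t]

theorem eps₂_one (t : TensorAlgebra C M) : eps₂ C M 1 t = 0 := by
  simp only [eps₂, LinearMap.compr₂_apply, freeEps_one, map_zero]

namespace GenShuffle
variable {C M}

theorem mulPure_comm (c : Constants₂ C M) (f : List M) (d : Constants₂ C M) (g : List M) :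
    mulPure C c f d g = mulPure C d g c f := by
  simp only [mulPure]
  rw [Finset.sum_comm, mul_comm c d, shuffle_comm]
  refine congrArg _ (Finset.sum_congr rfl fun j _ => Finset.sum_congr rfl fun i _ => ?_)
  rw [eps₂_comm, shuffle_comm]

theorem mulPure_multilinear_right (c : Constants₂ C M) (f : List M) (d : Constants₂ C M) :
    IsListMultilinear C (mulPure C c f d) := by
  refine ((shuffle_multilinear_right C M f).comp (mk C M (c * d))).add
    (IsListMultilinear.sum _ fun i => IsListMultilinear.sum_length fun j => ?_)
  refine IsListMultilinear.split (F := fun k l => tmul (c * d * eps₂ C M (pureTensor C (f.drop i))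
    (pureTensor C l)) (shuffle C (f.take i) k)) (fun l => ?_) (fun k => ?_) j
  · exact (shuffle_multilinear_right C M _).comp (mk C M _)
  · exact isListMultilinear_pureTensor.comp (((mk C M).flip (shuffle C (f.take i) k)) ∘ₗ
      LinearMap.mulLeft C (c * d) ∘ₗ eps₂ C M (pureTensor C (f.drop i)))

theorem mulPure_multilinear_left (c d : Constants₂ C M) (g : List M) :
    IsListMultilinear C fun f => mulPure C c f d g := by
  simpa only [mulPure_comm c _ d g] using mulPure_multilinear_right d g c

theorem mulPure_add_right (c : Constants₂ C M) (f : List M) (d d' : Constants₂ C M) (g : List M) :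
    mulPure C c f (d + d') g = mulPure C c f d g + mulPure C c f d' g := by
  simp only [mulPure, tmul, mul_add, add_mul, map_add, LinearMap.add_apply, Finset.sum_add_distrib]
  abel

theorem mulPure_smul_right (r : C) (c : Constants₂ C M) (f : List M) (d : Constants₂ C M)
    (g : List M) : mulPure C c f (r • d) g = r • mulPure C c f d g := by
  simp only [mulPure, tmul, mul_smul_comm, smul_mul_assoc, map_smul, LinearMap.smul_apply,
    Finset.smul_sum, smul_add]

variable (C M) in
/-- The multiplication of `𝒞₂ ⊗ 𝒯`, as a bilinear map. -/
def mulHom : GenShuffle C M →ₗ[C] GenShuffle C M →ₗ[C] GenShuffle C M :=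
  lift
    (fun c f => lift (fun d g => mulPure C c f d g) (fun _ _ _ => mulPure_add_right _ _ _ _ _)
      (fun _ _ _ => mulPure_smul_right _ _ _ _ _) (fun d => mulPure_multilinear_right c f d))
    (fun c c' f => hom_ext fun d g => by
      simp only [lift_tmul, LinearMap.add_apply, mulPure_comm _ f d g, mulPure_add_right])
    (fun r c f => hom_ext fun d g => by
      simp only [lift_tmul, LinearMap.smul_apply, mulPure_comm _ f d g, mulPure_smul_right])
    (fun c =>
      { map_add := fun l₁ x y l₂ => hom_ext fun d g => by
          simp only [lift_tmul, LinearMap.add_apply, (mulPure_multilinear_left c d g).map_add]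
        map_smul := fun l₁ r x l₂ => hom_ext fun d g => by
          simp only [lift_tmul, LinearMap.smul_apply, (mulPure_multilinear_left c d g).map_smul] })

instance : Mul (GenShuffle C M) := ⟨fun x y => mulHom C M x y⟩

instance : One (GenShuffle C M) := ⟨tmul 1 1⟩

theorem mul_eq_mulHom (x y : GenShuffle C M) : x * y = mulHom C M x y := rfl

theorem one_def : (1 : GenShuffle C M) = tmul 1 1 := rfl

theorem tmul_mul_tmul (c d : Constants₂ C M) (f g : List M) :
    tmul c (pureTensor C f) * tmul d (pureTensor C g) = mulPure C c f d g := by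
  simp only [mul_eq_mulHom, mulHom, lift_tmul]

end GenShuffle

end GeneralizedShuffle

section RingStructure
variable {C : Type*} [CommRing C] {M : Type*} [AddCommGroup M] [Module C M]
namespace GenShuffle

instance : Module (Constants₂ C M) (GenShuffle C M) :=
  inferInstanceAs (Module (Constants₂ C M) (Constants₂ C M ⊗[C] TensorAlgebra C M))

instance : IsScalarTower C (Constants₂ C M) (GenShuffle C M) :=
  inferInstanceAs (IsScalarTower C (Constants₂ C M) (Constants₂ C M ⊗[C] TensorAlgebra C M))

theorem smul_tmul (c d : Constants₂ C M) (t : TensorAlgebra C M) :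
    c • tmul d t = tmul (c * d) t := rfl

/-- Left multiplication by `a` in the tensor factor. -/
def consHom (a : M) : GenShuffle C M →ₗ[Constants₂ C M] GenShuffle C M :=
  TensorProduct.AlgebraTensorModule.lTensor (Constants₂ C M) (Constants₂ C M)
    (LinearMap.mulLeft C (TensorAlgebra.ι C a))

theorem consHom_tmul (a : M) (c : Constants₂ C M) (t : TensorAlgebra C M) :
    consHom a (tmul c t) = tmul c (TensorAlgebra.ι C a * t) := rfl

/-- The map `c ⊗ t ↦ c · ε(t ⊙ h)`. -/
def epsHom (h : List M) : GenShuffle C M →ₗ[Constants₂ C M] Constants₂ C M :=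
  TensorProduct.AlgebraTensorModule.lift
    (LinearMap.toSpanSingleton (Constants₂ C M) (TensorAlgebra C M →ₗ[C] Constants₂ C M)
      ((eps₂ C M).flip (pureTensor C h)))

theorem epsHom_tmul (h : List M) (c : Constants₂ C M) (t : TensorAlgebra C M) :
    epsHom h (tmul c t) = c * eps₂ C M t (pureTensor C h) := rfl

theorem tmul_add (c : Constants₂ C M) (t s : TensorAlgebra C M) :
    tmul c (t + s) = tmul c t + tmul c s := map_add _ _ _

theorem mulPure_eq_smul (c d : Constants₂ C M) (f g : List M) :
    mulPure C c f d g = (c * d) • mulPure C 1 f 1 g := by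
  simp only [mulPure, smul_add, Finset.smul_sum, smul_tmul, one_mul, mul_one]

theorem mul_comm' (x y : GenShuffle C M) : x * y = y * x := by
  suffices h : mulHom C M = (mulHom C M).flip from congr($h x y)
  refine hom_ext fun c f => hom_ext fun d g => ?_
  simp only [LinearMap.flip_apply, ← mul_eq_mulHom, tmul_mul_tmul]
  exact mulPure_comm c f d g

theorem smul_eq_lift (e : Constants₂ C M) (x : GenShuffle C M) :
    Module.toModuleEnd C (S := Constants₂ C M) (GenShuffle C M) e x = e • x := rfl

theorem mul_smul' (e : Constants₂ C M) (x y : GenShuffle C M) : x * (e • y) = e • (x * y) := by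
  suffices h : (mulHom C M).compl₂ (Module.toModuleEnd C (GenShuffle C M) e)
      = (mulHom C M).compr₂ (Module.toModuleEnd C (GenShuffle C M) e) from congr($h x y)
  refine hom_ext fun c f => hom_ext fun d g => ?_
  simp only [LinearMap.compl₂_apply, LinearMap.compr₂_apply, smul_eq_lift, smul_tmul,
    ← mul_eq_mulHom, tmul_mul_tmul, mulPure_eq_smul c, smul_smul]
  congr 1; ring

theorem smul_mul' (e : Constants₂ C M) (x y : GenShuffle C M) : (e • x) * y = e • (x * y) := by
  rw [mul_comm', mul_smul', mul_comm']

/-- `1 ⊗ f` for the pure tensor `f`. -/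
def pure (f : List M) : GenShuffle C M := tmul 1 (pureTensor C f)

theorem pure_mul_pure (f g : List M) : (pure f * pure g : GenShuffle C M) = mulPure C 1 f 1 g :=
  tmul_mul_tmul _ _ _ _

theorem pure_nil : (pure [] : GenShuffle C M) = 1 := rfl

theorem one_mul' (x : GenShuffle C M) : 1 * x = x := by
  suffices h : mulHom C M 1 = LinearMap.id from congr($h x)
  refine hom_ext fun c f => ?_
  rw [← mul_eq_mulHom, ← pure_nil, pure, tmul_mul_tmul]
  simp [mulPure, shuffle_nil_left]

theorem add_mul' (x y z : GenShuffle C M) : (x + y) * z = x * z + y * z := by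
  simp only [mul_eq_mulHom, map_add, LinearMap.add_apply]

theorem mul_add' (x y z : GenShuffle C M) : x * (y + z) = x * y + x * z := by
  simp only [mul_eq_mulHom, map_add]

theorem consHom_pure (a : M) (f : List M) :
    consHom a (pure f : GenShuffle C M) = pure (a :: f) := by
  simp [pure, consHom_tmul]

theorem pure_cons_mul (a b : M) (f g : List M) :
    (pure (a :: f) * pure (b :: g) : GenShuffle C M) =
      consHom a (pure f * pure (b :: g)) + consHom b (pure (a :: f) * pure g) +
        eps₂ C M (pureTensor C (a :: f)) (pureTensor C (b :: g)) • 1 := by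
  simp only [pure_mul_pure, mulPure, map_add, map_sum, consHom_tmul, one_mul, mul_one,
    List.length_cons]
  simp only [Finset.sum_range_succ', List.drop_succ_cons, List.take_succ_cons, List.drop_zero,
    List.take_zero, shuffle_nil_left, shuffle_nil_right, Finset.sum_add_distrib, shuffle,
    tmul_add, pureTensor_nil, one_def, smul_tmul, pureTensor_cons, mul_one]
  abel

theorem ext_pure (x : GenShuffle C M) : ∀ {p : GenShuffle C M → Prop}, p 0 →
    (∀ x y, p x → p y → p (x + y)) → (∀ (c : Constants₂ C M) f, p (c • pure f)) → p x := by
  intro p h0 hadd hp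
  have key : ∀ (c : Constants₂ C M) (t : TensorAlgebra C M), p (tmul c t) := by
    intro c t
    have ht : t ∈ Submodule.span C (Set.range (pureTensor C (M := M))) := by
      rw [span_pureTensor]; trivial
    induction ht using Submodule.span_induction generalizing c with
    | mem t h =>
      obtain ⟨l, rfl⟩ := h
      simpa [pure, smul_tmul] using hp c l
    | zero => simpa [tmul] using h0
    | add s t _ _ hs ht => rw [tmul_add]; exact hadd _ _ (hs c) (ht c)
    | smul r t _ ht =>
      have : tmul c (r • t) = tmul (r • c) t := by simp [tmul]
      rw [this]; exact ht _
  exact TensorProduct.induction_on x h0 key hadd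

theorem consHom_mul_consHom (a b : M) (x : GenShuffle C M) (g : List M) :
    consHom a x * pure (b :: g) =
      consHom a (x * pure (b :: g)) + consHom b (consHom a x * pure g) +
        epsHom (b :: g) (consHom a x) • 1 := by
  refine ext_pure x (p := fun x => consHom a x * pure (b :: g) =
      consHom a (x * pure (b :: g)) + consHom b (consHom a x * pure g) +
        epsHom (b :: g) (consHom a x) • 1) ?_ ?_ ?_
  · simp only [map_zero, mul_eq_mulHom, LinearMap.zero_apply, add_zero, zero_add]
    exact (zero_smul _ _).symm
  · intro x y hx hy
    simp only [map_add, add_mul', hx, hy, add_smul]; abel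
  · intro c f
    simp only [map_smul, smul_mul', consHom_pure, pure_cons_mul, smul_add, smul_smul, smul_eq_mul]
    congr 2
    simp only [pure, epsHom_tmul, one_mul]

theorem sum_Ico_eq {N : Type*} [AddCommGroup N] (j n : ℕ) (F : ℕ → N)
    (h : j = 0 → F 0 = 0) : ∑ i ∈ Finset.Ico (1 - j) n, F i = ∑ i ∈ Finset.range n, F i := by
  rw [Finset.range_eq_Ico]
  refine Finset.sum_subset (Finset.Ico_subset_Ico (Nat.zero_le _) le_rfl) fun i hi hi' => ?_
  simp only [Finset.mem_Ico, not_and, not_lt] at hi hi'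
  have : i = 0 ∧ j = 0 := by
    by_contra hc
    have := hi' (by omega)
    omega
  rw [this.1]; exact h this.2

theorem epsHom_mul (f g h : List M) (hf : f ≠ []) (hg : g ≠ []) (hh : h ≠ []) :
    epsHom h (pure f * pure g : GenShuffle C M) = epsHom f (pure g * pure h : GenShuffle C M) := by
  have hrel : toConstants₂ C M (constantRelation C f g h) = 0 := by
    exact Ideal.Quotient.eq_zero_iff_mem.mpr
      (Ideal.subset_span ⟨f, g, h, hf, hg, hh, rfl⟩)
  have he : ∀ s t, toConstants₂ C M (freeEps C M s t) =
    eps₂ C M s t := fun _ _ => rfl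
  simp only [constantRelation, map_add, map_sub, map_sum, map_mul, he] at hrel
  have h1 : ∀ j, ∑ i ∈ Finset.Ico (1 - j) f.length,
          eps₂ C M (pureTensor C (f.drop i)) (pureTensor C (g.drop j)) *
            eps₂ C M (shuffle C (f.take i) (g.take j)) (pureTensor C h) =
      ∑ i ∈ Finset.range f.length,
          eps₂ C M (pureTensor C (f.drop i)) (pureTensor C (g.drop j)) *
            eps₂ C M (shuffle C (f.take i) (g.take j)) (pureTensor C h) := fun j =>
    sum_Ico_eq _ _ _ (by rintro rfl; simp [shuffle_nil_left, eps₂_one])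
  have h2 : ∀ j, ∑ k ∈ Finset.Ico (1 - j) h.length,
          eps₂ C M (pureTensor C f) (shuffle C (g.take j) (h.take k)) *
            eps₂ C M (pureTensor C (g.drop j)) (pureTensor C (h.drop k)) =
      ∑ k ∈ Finset.range h.length,
          eps₂ C M (pureTensor C f) (shuffle C (g.take j) (h.take k)) *
            eps₂ C M (pureTensor C (g.drop j)) (pureTensor C (h.drop k)) := fun j =>
    sum_Ico_eq _ _ _ (by
      rintro rfl; simp [shuffle_nil_left, eps₂_one, eps₂_comm C M (pureTensor C f)])
  simp only [h1, h2, Finset.sum_sub_distrib] at hrel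
  rw [Finset.sum_comm] at hrel
  simp only [pure_mul_pure, mulPure, map_add, map_sum, epsHom_tmul, one_mul, mul_one]
  rw [← sub_eq_zero, ← hrel]
  simp only [eps₂_comm C M _ (pureTensor C f),
    mul_comm (eps₂ C M (pureTensor C f) _)]
  abel

theorem assoc_pure (f g h : List M) :
    (pure f * pure g * pure h : GenShuffle C M) = pure g * pure h * pure f := by
  induction hn : f.length + g.length + h.length using Nat.strong_induction_on
    generalizing f g h with
  | _ n ih =>
  subst hn
  match f, g, h with
  | [], g, h => rw [pure_nil, one_mul', mul_comm' _ 1, one_mul']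
  | f, [], h => rw [pure_nil, one_mul', mul_comm' _ 1, one_mul', mul_comm']
  | f, g, [] => rw [pure_nil, mul_comm' _ 1, mul_comm' _ 1, one_mul', one_mul', mul_comm']
  | a :: f, b :: g, c :: h =>
    have e := epsHom_mul (C := C) (a :: f) (b :: g) (c :: h) (by simp) (by simp) (by simp)
    have i1 := ih _ (by simp) f (b :: g) (c :: h) rfl
    have i2 := ih _ (by simp) (a :: f) g (c :: h) rfl
    have i3 := ih _ (by simp) (a :: f) (b :: g) h rfl
    have key : ∀ (a b c : M) (f g h : List M),
        (pure (a :: f) * pure (b :: g) * pure (c :: h) : GenShuffle C M) =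
        consHom a (pure f * pure (b :: g) * pure (c :: h)) +
        consHom b (pure (a :: f) * pure g * pure (c :: h)) +
        consHom c (pure (a :: f) * pure (b :: g) * pure h) +
        epsHom (c :: h) (pure (a :: f) * pure (b :: g) : GenShuffle C M) • 1 := by
      intro a b c f g h
      have h0 : epsHom (c :: h) (1 : GenShuffle C M) = 0 := by
        rw [one_def, epsHom_tmul, eps₂_one, mul_zero]
      rw [pure_cons_mul]
      simp only [add_mul', consHom_mul_consHom, smul_mul', one_mul', map_add, map_smul,
        consHom_pure, h0, smul_zero, add_zero, add_smul]
      abel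
    rw [key, key, e, i1, i2, i3]
    abel

theorem mul_assoc' (x y z : GenShuffle C M) : x * y * z = x * (y * z) := by
  rw [mul_comm' x (y * z)]
  refine ext_pure x (p := fun x => x * y * z = y * z * x) ?_ ?_ ?_
  · simp only [mul_eq_mulHom, map_zero, LinearMap.zero_apply]
  · intro x x' hx hx'; simp only [mul_add', add_mul', hx, hx']
  intro c f
  simp only [smul_mul', mul_smul']
  congr 1
  refine ext_pure y (p := fun y => pure f * y * z = y * z * pure f) ?_ ?_ ?_
  · simp only [mul_eq_mulHom, map_zero, LinearMap.zero_apply]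
  · intro x x' hx hx'; simp only [mul_add', add_mul', hx, hx']
  intro d g
  simp only [smul_mul', mul_smul']
  congr 1
  refine ext_pure z (p := fun z => pure f * pure g * z = pure g * z * pure f) ?_ ?_ ?_
  · simp only [mul_eq_mulHom, map_zero, LinearMap.zero_apply]
  · intro x x' hx hx'; simp only [mul_add', add_mul', hx, hx']
  intro e h
  simp only [smul_mul', mul_smul']
  congr 1
  exact assoc_pure f g h

instance : CommRing (GenShuffle C M) :=
  { (inferInstance : AddCommGroup (GenShuffle C M)) with
    mul_assoc := mul_assoc'
    mul_comm := mul_comm'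
    one_mul := one_mul'
    mul_one := fun x => by rw [mul_comm', one_mul']
    left_distrib := mul_add'
    right_distrib := add_mul'
    zero_mul := fun x => by simp [mul_eq_mulHom]
    mul_zero := fun x => by simp [mul_eq_mulHom] }

instance : Algebra C (GenShuffle C M) :=
  Algebra.ofModule (fun r x y => by simp only [mul_eq_mulHom, map_smul, LinearMap.smul_apply])
    (fun r x y => by simp only [mul_eq_mulHom, map_smul])

end GenShuffle
end RingStructure

section IntegroDifferentialRing

/-- The constants of a differential ring. -/
def constants {S : Type*} [CommRing S] (D : Derivation ℤ S S) : Subring S where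
  carrier := {c | D c = 0}
  mul_mem' := fun {a b} ha hb => by
    simp only [Set.mem_ofPred_eq] at ha hb ⊢
    simp [ha, hb]
  one_mem' := by simp
  add_mem' := fun {a b} ha hb => by
    simp only [Set.mem_ofPred_eq] at ha hb ⊢
    simp [ha, hb]
  zero_mem' := by simp
  neg_mem' := fun {a} ha => by
    simp only [Set.mem_ofPred_eq] at ha ⊢
    simp [ha]

/-- An integration on a commutative differential ring `(S, ∂)`: a map that is linear over the
constants of `∂` and a right inverse of `∂`. A commutative ring with a derivation and an
integration is a commutative integro-differential ring. -/
structure IsIntegration {S : Type*} [CommRing S] (D : Derivation ℤ S S) (I : S → S) : Prop where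
  map_add : ∀ f g, I (f + g) = I f + I g
  map_smul : ∀ c ∈ constants D, ∀ f, I (c * f) = c * I f
  deriv_int : ∀ f, D (I f) = f

/-- The nested integral `∫ f₁ ∫ f₂ ⋯ ∫ fₙ`; it is `1` for the empty list. -/
def nestedIntegral {S : Type*} [CommRing S] (I : S → S) : List S → S
  | [] => 1
  | f :: l => I (f * nestedIntegral I l)

/-- A derivation, as a derivation over its ring of constants. -/
def overConstants {S : Type*} [CommRing S] (D : Derivation ℤ S S) :
    Derivation (constants D) S S where
  toFun := D
  map_add' := map_add D
  map_smul' c f := by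
    have h : D (c : S) = 0 := c.2
    simp [Subring.smul_def, h]
  map_one_eq_zero' := D.map_one_eq_zero
  leibniz' := D.leibniz

variable {C R : Type*} [CommRing C] [CommRing R] [Algebra C R]

/-- A quasi-integration on a commutative differential ring `(R, D)`, where `C` is the ring of
constants of `D`. -/
structure QuasiIntegration (D : Derivation C R R) extends R →ₗ[C] R where
  deriv_quasi_deriv : ∀ f, D (toFun (D f)) = D f
  quasi_deriv_quasi : ∀ f, toFun (D (toFun f)) = toFun f

variable {D : Derivation C R R}

namespace QuasiIntegration
variable (Q : QuasiIntegration D)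

instance : CoeFun (QuasiIntegration D) fun _ => R → R := ⟨fun Q => Q.toFun⟩

theorem map_add_apply (f g : R) : Q (f + g) = Q f + Q g := Q.toLinearMap.map_add f g

theorem map_smul_apply (c : C) (f : R) : Q (c • f) = c • Q f :=
  Q.toLinearMap.map_smul c f

/-- The image `R_J` of the quasi-integration. -/
abbrev J : Submodule C R := LinearMap.range Q.toLinearMap

/-- The kernel `R_T` of the quasi-integration. -/
abbrev T : Submodule C R := LinearMap.ker Q.toLinearMap

/-- `Q f` as an element of `R_J`. -/
def quasi : R →ₗ[C] Q.J := Q.toLinearMap.rangeRestrict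

/-- `f - ∂ Q f` as an element of `R_T`. -/
def rest : R →ₗ[C] Q.T where
  toFun f := ⟨f - D (Q f), by
    have := Q.quasi_deriv_quasi f
    have h := Q.toLinearMap.map_sub f (D (Q f))
    exact LinearMap.mem_ker.mpr (h.trans (sub_eq_zero.mpr this.symm))⟩
  map_add' f g := by
    apply Subtype.ext
    simp only [Submodule.coe_add, Q.map_add_apply, map_add]; abel
  map_smul' c f := by
    apply Subtype.ext
    simp only [Q.map_smul_apply, Derivation.map_smul, smul_sub, RingHom.id_apply, Submodule.coe_smul]

/-- The tensor algebra `𝒯` of `R_T`. -/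
abbrev Tensors : Type _ := TensorAlgebra C Q.T

/-- The algebra `𝒞₁ = Sym(R_J ⊗ 𝒯)` of constants that arise from products of elements of `R_J`
with nested integrals. -/
def Constants₁ : Type _ := SymmetricAlgebra C (Q.J ⊗[C] Q.Tensors)

instance : CommRing Q.Constants₁ :=
  inferInstanceAs (CommRing (SymmetricAlgebra C (Q.J ⊗[C] Q.Tensors)))

instance : Algebra C Q.Constants₁ :=
  inferInstanceAs
    (Algebra C (SymmetricAlgebra C (Q.J ⊗[C] Q.Tensors)))

/-- The map `ε : R_J ⊗ 𝒯 → 𝒞₁`. -/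
def eps₁ : Q.J ⊗[C] Q.Tensors →ₗ[C] Q.Constants₁ :=
  SymmetricAlgebra.ι C (Q.J ⊗[C] Q.Tensors)

/-- The tensor product `R ⊗ 𝒞₁ ⊗ (𝒞₂ ⊗ 𝒯)` underlying `IDR(R)`. -/
abbrev IDRModule : Type _ := R ⊗[C] (Q.Constants₁ ⊗[C] GenShuffle C Q.T)

/-- The `𝒞`-algebra `IDR(R) = R ⊗ 𝒞₁ ⊗ (𝒞₂ ⊗ 𝒯)`, as tensor product of commutative algebras. -/
def IDR : Type _ := Q.IDRModule

instance : CommRing Q.IDR :=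
  inferInstanceAs (CommRing (Q.IDRModule))

instance : Algebra C Q.IDR :=
  inferInstanceAs (Algebra C (Q.IDRModule))

/-- The element `f₀ ⊗ c₁ ⊗ c₂ ⊗ t` of `IDR(R)`. -/
def tmul (f₀ : R) (c₁ : Q.Constants₁) (c₂ : Constants₂ C Q.T) (t : Q.Tensors) :
    Q.IDR :=
  (f₀ ⊗ₜ[C] (c₁ ⊗ₜ[C] GenShuffle.tmul c₂ t) : Q.IDRModule)

/-- The canonical algebra homomorphism `f ↦ f ⊗ 1 ⊗ 1 ⊗ 1`. -/
def ι : R →ₐ[C] Q.IDR :=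
  (Algebra.TensorProduct.includeLeft : R →ₐ[C] Q.IDRModule)

theorem ι_apply (f : R) : Q.ι f = Q.tmul f 1 1 1 := rfl

/-- The derivative of `f₀ ⊗ c₁ ⊗ c₂ ⊗ f` for a pure tensor `f`. -/
def derivPure : List Q.T → R → Q.Constants₁ → Constants₂ C Q.T → Q.IDR
  | [], f₀, c₁, c₂ => Q.tmul (D f₀) c₁ c₂ 1
  | f₁ :: f, f₀, c₁, c₂ =>
      Q.tmul (D f₀) c₁ c₂ (pureTensor C (f₁ :: f)) +
        Q.tmul (f₀ * f₁) c₁ c₂ (pureTensor C f)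

/-- The integral of `f₀ ⊗ c₁ ⊗ c₂ ⊗ f` for a pure tensor `f`. -/
def intPure : List Q.T → R → Q.Constants₁ → Constants₂ C Q.T → Q.IDR
  | [], f₀, c₁, c₂ =>
      Q.tmul (Q f₀) c₁ c₂ 1 -
        Q.tmul 1 (c₁ * Q.eps₁ (Q.quasi f₀ ⊗ₜ 1)) c₂ 1 +
        Q.tmul 1 c₁ c₂ (pureTensor C [Q.rest f₀])
  | f₁ :: f, f₀, c₁, c₂ =>
      Q.tmul (Q f₀) c₁ c₂ (pureTensor C (f₁ :: f)) -
        Q.tmul 1 (c₁ * Q.eps₁ (Q.quasi f₀ ⊗ₜ pureTensor C (f₁ :: f))) c₂ 1 -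
        intPure f (Q f₀ * f₁) c₁ c₂ +
        Q.tmul 1 c₁ c₂ (pureTensor C (Q.rest f₀ :: f₁ :: f))

/-- Linearity over the constants in every argument. -/
structure IsMultilinear {N : Type*} [AddCommGroup N] [Module C N]
    (F : List Q.T → R → Q.Constants₁ → Constants₂ C Q.T → N) : Prop where
  list : ∀ f₀ c₁ c₂, IsListMultilinear C fun l => F l f₀ c₁ c₂
  add₀ : ∀ l f₀ f₀' c₁ c₂, F l (f₀ + f₀') c₁ c₂ = F l f₀ c₁ c₂ + F l f₀' c₁ c₂
  smul₀ : ∀ l (r : C) f₀ c₁ c₂, F l (r • f₀) c₁ c₂ = r • F l f₀ c₁ c₂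
  add₁ : ∀ l f₀ c₁ c₁' c₂, F l f₀ (c₁ + c₁') c₂ = F l f₀ c₁ c₂ + F l f₀ c₁' c₂
  smul₁ : ∀ l (r : C) f₀ c₁ c₂, F l f₀ (r • c₁) c₂ = r • F l f₀ c₁ c₂
  add₂ : ∀ l f₀ c₁ c₂ c₂', F l f₀ c₁ (c₂ + c₂') = F l f₀ c₁ c₂ + F l f₀ c₁ c₂'
  smul₂ : ∀ l (r : C) f₀ c₁ c₂, F l f₀ c₁ (r • c₂) = r • F l f₀ c₁ c₂

section lift
variable {N : Type*} [AddCommGroup N] [Module C N]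
  (F : List Q.T → R → Q.Constants₁ → Constants₂ C Q.T → N) (hF : Q.IsMultilinear F)

/-- The linear map on `IDR(R)` with prescribed values on `f₀ ⊗ c₁ ⊗ c₂ ⊗ f` for pure
tensors `f`. -/
def lift : Q.IDR →ₗ[C] N :=
  (TensorProduct.lift
    { toFun := fun f₀ => TensorProduct.lift
        { toFun := fun c₁ => GenShuffle.lift (fun c₂ l => F l f₀ c₁ c₂)
            (fun _ _ _ => hF.add₂ _ _ _ _ _) (fun _ _ _ => hF.smul₂ _ _ _ _ _)
            (fun c₂ => hF.list f₀ c₁ c₂)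
          map_add' := fun c₁ c₁' => GenShuffle.hom_ext fun c₂ l => by
            simp only [GenShuffle.lift_tmul, LinearMap.add_apply, hF.add₁]
          map_smul' := fun r c₁ => GenShuffle.hom_ext fun c₂ l => by
            simp only [GenShuffle.lift_tmul, LinearMap.smul_apply, hF.smul₁, RingHom.id_apply] }
      map_add' := fun f₀ f₀' => TensorProduct.ext <| LinearMap.ext fun c₁ =>
        GenShuffle.hom_ext fun c₂ l => by
          simp only [LinearMap.compr₂ₛₗ_apply, TensorProduct.mk_apply, TensorProduct.lift.tmul,
            LinearMap.coe_mk, AddHom.coe_mk, GenShuffle.lift_tmul, LinearMap.add_apply, hF.add₀]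
      map_smul' := fun r f₀ => TensorProduct.ext <| LinearMap.ext fun c₁ =>
        GenShuffle.hom_ext fun c₂ l => by
          simp only [LinearMap.compr₂ₛₗ_apply, TensorProduct.mk_apply, TensorProduct.lift.tmul,
            LinearMap.coe_mk, AddHom.coe_mk, GenShuffle.lift_tmul, LinearMap.smul_apply,
            hF.smul₀, RingHom.id_apply] } :
    Q.IDRModule →ₗ[C] N)

theorem lift_tmul (l : List Q.T) (f₀ : R) (c₁ : Q.Constants₁)
    (c₂ : Constants₂ C Q.T) :
    Q.lift F hF (Q.tmul f₀ c₁ c₂ (pureTensor C l)) = F l f₀ c₁ c₂ :=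
  GenShuffle.lift_tmul (fun c₂ l => F l f₀ c₁ c₂) (fun _ _ _ => hF.add₂ _ _ _ _ _)
    (fun _ _ _ => hF.smul₂ _ _ _ _ _) (fun c₂ => hF.list f₀ c₁ c₂) c₂ l

end lift

theorem tmul_add₀ (f₀ f₀' : R) (c₁ : Q.Constants₁) (c₂ : Constants₂ C Q.T)
    (t : Q.Tensors) : Q.tmul (f₀ + f₀') c₁ c₂ t = Q.tmul f₀ c₁ c₂ t + Q.tmul f₀' c₁ c₂ t :=
  TensorProduct.add_tmul _ _ _

theorem tmul_smul₀ (r : C) (f₀ : R) (c₁ : Q.Constants₁)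
    (c₂ : Constants₂ C Q.T) (t : Q.Tensors) :
    Q.tmul (r • f₀) c₁ c₂ t = r • Q.tmul f₀ c₁ c₂ t :=
  (TensorProduct.smul_tmul' _ _ _).symm

theorem tmul_add₁ (f₀ : R) (c₁ c₁' : Q.Constants₁) (c₂ : Constants₂ C Q.T)
    (t : Q.Tensors) :
    Q.tmul f₀ (c₁ + c₁') c₂ t = Q.tmul f₀ c₁ c₂ t + Q.tmul f₀ c₁' c₂ t := by
  have h : (f₀ ⊗ₜ[C] ((c₁ + c₁') ⊗ₜ[C] GenShuffle.tmul c₂ t) : Q.IDRModule) =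
      f₀ ⊗ₜ[C] (c₁ ⊗ₜ[C] GenShuffle.tmul c₂ t) +
        f₀ ⊗ₜ[C] (c₁' ⊗ₜ[C] GenShuffle.tmul c₂ t) := by
    simp only [TensorProduct.add_tmul, TensorProduct.tmul_add]
  exact h

theorem tmul_smul₁ (r : C) (f₀ : R) (c₁ : Q.Constants₁) (c₂ : Constants₂ C Q.T) (t : Q.Tensors) :
    Q.tmul f₀ (r • c₁) c₂ t = r • Q.tmul f₀ c₁ c₂ t := by
  have h : (f₀ ⊗ₜ[C] ((r • c₁) ⊗ₜ[C] GenShuffle.tmul c₂ t) : Q.IDRModule) =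
      r • (f₀ ⊗ₜ[C] (c₁ ⊗ₜ[C] GenShuffle.tmul c₂ t)) := by
    simp only [← TensorProduct.smul_tmul', TensorProduct.tmul_smul]
  exact h

theorem tmul_add₂ (f₀ : R) (c₁ : Q.Constants₁) (c₂ c₂' : Constants₂ C Q.T)
    (t : Q.Tensors) :
    Q.tmul f₀ c₁ (c₂ + c₂') t = Q.tmul f₀ c₁ c₂ t + Q.tmul f₀ c₁ c₂' t := by
  have h : (f₀ ⊗ₜ[C] (c₁ ⊗ₜ[C] GenShuffle.tmul (c₂ + c₂') t) : Q.IDRModule) =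
      f₀ ⊗ₜ[C] (c₁ ⊗ₜ[C] GenShuffle.tmul c₂ t) +
        f₀ ⊗ₜ[C] (c₁ ⊗ₜ[C] GenShuffle.tmul c₂' t) := by
    simp only [GenShuffle.tmul, map_add, LinearMap.add_apply, TensorProduct.tmul_add]
  exact h

theorem tmul_smul₂ (r : C) (f₀ : R) (c₁ : Q.Constants₁) (c₂ : Constants₂ C Q.T) (t : Q.Tensors) :
    Q.tmul f₀ c₁ (r • c₂) t = r • Q.tmul f₀ c₁ c₂ t := by
  have h : (f₀ ⊗ₜ[C] (c₁ ⊗ₜ[C] GenShuffle.tmul (r • c₂) t) : Q.IDRModule) =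
      r • (f₀ ⊗ₜ[C] (c₁ ⊗ₜ[C] GenShuffle.tmul c₂ t)) := by
    simp only [GenShuffle.tmul, map_smul, LinearMap.smul_apply, TensorProduct.tmul_smul]
  exact h

theorem tmul_add₃ (f₀ : R) (c₁ : Q.Constants₁) (c₂ : Constants₂ C Q.T)
    (t t' : Q.Tensors) :
    Q.tmul f₀ c₁ c₂ (t + t') = Q.tmul f₀ c₁ c₂ t + Q.tmul f₀ c₁ c₂ t' := by
  have h : (f₀ ⊗ₜ[C] (c₁ ⊗ₜ[C] GenShuffle.tmul c₂ (t + t')) : Q.IDRModule) =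
      f₀ ⊗ₜ[C] (c₁ ⊗ₜ[C] GenShuffle.tmul c₂ t) +
        f₀ ⊗ₜ[C] (c₁ ⊗ₜ[C] GenShuffle.tmul c₂ t') := by
    simp only [GenShuffle.tmul, map_add, TensorProduct.tmul_add]
  exact h

theorem tmul_smul₃ (r : C) (f₀ : R) (c₁ : Q.Constants₁) (c₂ : Constants₂ C Q.T) (t : Q.Tensors) :
    Q.tmul f₀ c₁ c₂ (r • t) = r • Q.tmul f₀ c₁ c₂ t := by
  have h : (f₀ ⊗ₜ[C] (c₁ ⊗ₜ[C] GenShuffle.tmul c₂ (r • t)) : Q.IDRModule) =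
      r • (f₀ ⊗ₜ[C] (c₁ ⊗ₜ[C] GenShuffle.tmul c₂ t)) := by
    simp only [GenShuffle.tmul, map_smul, TensorProduct.tmul_smul]
  exact h

theorem derivPure_multilinear : Q.IsMultilinear Q.derivPure where
  list f₀ c₁ c₂ :=
    { map_add := fun l₁ x y l₂ => by
        cases l₁ with
        | nil =>
          simp only [List.nil_append, derivPure, pureTensor_cons, map_add, add_mul, mul_add,
            tmul_add₃, Submodule.coe_add, tmul_add₀]
          abel
        | cons a l₁ =>
          simp only [List.cons_append, derivPure, pureTensor_cons,
            isListMultilinear_pureTensor.map_add, mul_add, tmul_add₃]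
          abel
      map_smul := fun l₁ r x l₂ => by
        cases l₁ with
        | nil =>
          simp only [List.nil_append, derivPure, pureTensor_cons, map_smul, smul_mul_assoc,
            mul_smul_comm, tmul_smul₃, Submodule.coe_smul, tmul_smul₀, smul_add]
        | cons a l₁ =>
          simp only [List.cons_append, derivPure, pureTensor_cons,
            isListMultilinear_pureTensor.map_smul, mul_smul_comm, tmul_smul₃, smul_add] }
  add₀ l f₀ f₀' c₁ c₂ := by
    cases l <;> simp only [derivPure, map_add, add_mul, tmul_add₀]
    abel
  smul₀ l r f₀ c₁ c₂ := by
    cases l <;> simp only [derivPure, Derivation.map_smul, smul_mul_assoc, tmul_smul₀, smul_add]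
  add₁ l f₀ c₁ c₁' c₂ := by
    cases l <;> simp only [derivPure, tmul_add₁]
    abel
  smul₁ l r f₀ c₁ c₂ := by
    cases l <;> simp only [derivPure, tmul_smul₁, smul_add]
  add₂ l f₀ c₁ c₁' c₂ := by
    cases l <;> simp only [derivPure, tmul_add₂]
    abel
  smul₂ l r f₀ c₁ c₂ := by
    cases l <;> simp only [derivPure, tmul_smul₂, smul_add]

theorem intPure_add₀ (l : List Q.T) (f₀ f₀' : R) (c₁ : Q.Constants₁)
    (c₂ : Constants₂ C Q.T) :
    Q.intPure l (f₀ + f₀') c₁ c₂ = Q.intPure l f₀ c₁ c₂ + Q.intPure l f₀' c₁ c₂ := by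
  induction l generalizing f₀ f₀' with
  | nil =>
    simp only [intPure, Q.map_add_apply, map_add, pureTensor_cons, add_mul, mul_add,
      TensorProduct.add_tmul, tmul_add₀, tmul_add₁, tmul_add₃]
    abel
  | cons a l ih =>
    simp only [intPure, Q.map_add_apply, map_add, pureTensor_cons, add_mul, mul_add,
      TensorProduct.add_tmul, tmul_add₀, tmul_add₁, tmul_add₃, ih]
    abel

theorem intPure_smul₀ (l : List Q.T) (r : C) (f₀ : R) (c₁ : Q.Constants₁)
    (c₂ : Constants₂ C Q.T) :
    Q.intPure l (r • f₀) c₁ c₂ = r • Q.intPure l f₀ c₁ c₂ := by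
  induction l generalizing f₀ with
  | nil =>
    simp only [intPure, Q.map_smul_apply, map_smul, pureTensor_cons, smul_mul_assoc,
      mul_smul_comm, ← TensorProduct.smul_tmul', tmul_smul₀, tmul_smul₁, tmul_smul₃, smul_add,
      smul_sub]
  | cons a l ih =>
    simp only [intPure, Q.map_smul_apply, map_smul, pureTensor_cons, smul_mul_assoc,
      mul_smul_comm, ← TensorProduct.smul_tmul', tmul_smul₀, tmul_smul₁, tmul_smul₃, smul_add,
      smul_sub, ih]

theorem intPure_multilinear : Q.IsMultilinear Q.intPure where
  list f₀ c₁ c₂ :=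
    { map_add := fun l₁ x y l₂ => by
        induction l₁ generalizing f₀ with
        | nil =>
          simp only [List.nil_append, intPure, pureTensor_cons, map_add, add_mul, mul_add,
            tmul_add₃, tmul_add₁, TensorProduct.tmul_add, Submodule.coe_add, intPure_add₀]
          abel
        | cons a l₁ ih =>
          simp only [List.cons_append, intPure, pureTensor_cons, ih, map_add,
            isListMultilinear_pureTensor.map_add, mul_add, tmul_add₃, tmul_add₁,
            TensorProduct.tmul_add]
          abel
      map_smul := fun l₁ r x l₂ => by
        induction l₁ generalizing f₀ with
        | nil =>
          simp only [List.nil_append, intPure, pureTensor_cons, map_smul, smul_mul_assoc,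
            mul_smul_comm, tmul_smul₃, tmul_smul₁, TensorProduct.tmul_smul, Submodule.coe_smul,
            intPure_smul₀, smul_add, smul_sub]
        | cons a l₁ ih =>
          simp only [List.cons_append, intPure, pureTensor_cons, ih, map_smul,
            isListMultilinear_pureTensor.map_smul, mul_smul_comm, tmul_smul₃, tmul_smul₁,
            TensorProduct.tmul_smul, smul_add, smul_sub] }
  add₀ := Q.intPure_add₀
  smul₀ := Q.intPure_smul₀
  add₁ l f₀ c₁ c₁' c₂ := by
    induction l generalizing f₀ with
    | nil => simp only [intPure, tmul_add₁, add_mul]; abel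
    | cons a l ih => simp only [intPure, tmul_add₁, add_mul, ih]; abel
  smul₁ l r f₀ c₁ c₂ := by
    induction l generalizing f₀ with
    | nil => simp only [intPure, tmul_smul₁, smul_mul_assoc, smul_add, smul_sub]
    | cons a l ih => simp only [intPure, tmul_smul₁, smul_mul_assoc, smul_add, smul_sub, ih]
  add₂ l f₀ c₁ c₁' c₂ := by
    induction l generalizing f₀ with
    | nil => simp only [intPure, tmul_add₂]; abel
    | cons a l ih => simp only [intPure, tmul_add₂, ih]; abel
  smul₂ l r f₀ c₁ c₂ := by
    induction l generalizing f₀ with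
    | nil => simp only [intPure, tmul_smul₂, smul_add, smul_sub]
    | cons a l ih => simp only [intPure, tmul_smul₂, smul_add, smul_sub, ih]

/-- The derivation on `IDR(R)`, as a linear map. -/
def deriv : Q.IDR →ₗ[C] Q.IDR := Q.lift Q.derivPure Q.derivPure_multilinear

/-- The integration on `IDR(R)`. -/
def int : Q.IDR →ₗ[C] Q.IDR := Q.lift Q.intPure Q.intPure_multilinear

theorem deriv_tmul (l : List Q.T) (f₀ : R) (c₁ : Q.Constants₁)
    (c₂ : Constants₂ C Q.T) :
    Q.deriv (Q.tmul f₀ c₁ c₂ (pureTensor C l)) = Q.derivPure l f₀ c₁ c₂ :=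
  Q.lift_tmul _ _ _ _ _ _

theorem int_tmul (l : List Q.T) (f₀ : R) (c₁ : Q.Constants₁)
    (c₂ : Constants₂ C Q.T) :
    Q.int (Q.tmul f₀ c₁ c₂ (pureTensor C l)) = Q.intPure l f₀ c₁ c₂ :=
  Q.lift_tmul _ _ _ _ _ _

end QuasiIntegration
end IntegroDifferentialRing

end IntDiff
end

/-! The ring axioms for `𝒞₂ ⊗ 𝒯` are already in place, so what remains is the analysis: Leibniz
rule, `∂∫ = id`, linearity of `∫` over the constants, injectivity of `ι`, and nested integrals.

Injectivity: sending every `ε(…)` and every tensor of positive order to zero gives a linear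
retraction of `IDR(R)` onto `R`. It is well defined on `𝒞₂` because every term of a relation
contains a factor `ε(…)`.

Leibniz rule: `∂` treats `𝒞₁` and `𝒞₂` as constants, so the question reduces to `𝒞₂ ⊗ 𝒯`. There the
product is recursive, `(a ⊗ f)(b ⊗ g) = a ⊗ (f · (b ⊗ g)) + b ⊗ ((a ⊗ f) · g) + ε((a ⊗ f) ⊙ (b ⊗
g))`, which is integration by parts with an integration constant. Since `∂` removes a leading tensor
factor and kills the last term, this formula differentiates directly to the product rule
(`genShuffleDeriv_mul`, `deriv_mul`).

Right inverse: `f₀ = ∂Qf₀ + (f₀ - ∂Qf₀)`, and the recursive integral in `∫` cancels the extra term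
produced by differentiating the tensor factor (`deriv_intPure`).

Linearity over constants: `∫` visibly commutes with multiplication by `1 ⊗ c₁ ⊗ c₂ ⊗ 1`, so it is
enough that these elements span all constants. The evaluation `x - ∫∂x` always lies in their span
(`sub_int_deriv_mem`), and it equals `x` when `∂x = 0`.

Nested integrals: `Q` vanishes on `R_T`, so integrating an element of `R_T` times a pure tensor
simply prepends a tensor factor (`intPure_coe`). -/

noncomputable section
namespace IntDiff

/-! ### Augmentations of `𝒞₂` and of `𝒞₂ ⊗ 𝒯` -/

section Retraction
variable {C : Type*} [CommRing C] {M : Type*} [AddCommGroup M] [Module C M]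

variable (C M) in
/-- The augmentation of the symmetric algebra, which sends all `ε(f ⊙ g)` to zero. -/
def freeConstantsAugmentation : FreeConstants C M →ₐ[C] C :=
  (SymmetricAlgebra.algebraMapInv :
    SymmetricAlgebra C (SymmetricSquare C (positivePart C M)) →ₐ[C] C)

theorem freeConstantsAugmentation_freeEps (s t : TensorAlgebra C M) :
    freeConstantsAugmentation C M (freeEps C M s t) = 0 :=
  SymmetricAlgebra.lift_ι_apply (f := (0 : SymmetricSquare C (positivePart C M) →ₗ[C] C)) _

variable (C M) in
/-- The augmentation of `𝒞₂`, which sends all `ε(f ⊙ g)` to zero. -/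
def constants₂Augmentation : Constants₂ C M →ₐ[C] C :=
  Ideal.Quotient.liftₐ (constantRelations C M)
    (freeConstantsAugmentation C M) (by
      suffices h : constantRelations C M ≤ RingHom.ker (freeConstantsAugmentation C M) from
        fun a ha => h ha
      refine Ideal.span_le.mpr ?_
      rintro _ ⟨f, g, h, -, -, -, rfl⟩
      refine RingHom.mem_ker.mpr ?_
      -- Each summand of a relation is an `ε(…)` or a product of two of them, so its augmentation is
      -- zero.
      simp only [constantRelation, map_add, map_sub, map_sum, map_mul,
        freeConstantsAugmentation_freeEps, mul_zero, sub_zero, Finset.sum_const_zero, add_zero])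

variable (C M) in
/-- The linear map `c ⊗ t ↦ (augmentation of c) · (augmentation of t)`. -/
def genShuffleAugmentation : GenShuffle C M →ₗ[C] C :=
  TensorProduct.lift ((LinearMap.mul C C).compl₁₂ (constants₂Augmentation C M).toLinearMap
    (TensorAlgebra.algebraMapInv (R := C) (M := M)).toLinearMap)

theorem genShuffleAugmentation_one : genShuffleAugmentation C M 1 = 1 := by
  have : genShuffleAugmentation C M 1 = constants₂Augmentation C M 1 *
    TensorAlgebra.algebraMapInv (R := C) (M := M) 1 := TensorProduct.lift.tmul _ _
  rw [this, map_one, map_one, one_mul]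

end Retraction

/-! ### Injectivity of the embedding of `R` -/

namespace QuasiIntegration
variable {C R : Type*} [CommRing C] [CommRing R] [Algebra C R] {D : Derivation C R R}
  (Q : QuasiIntegration D)

/-- The three augmentations combine to a left inverse of `ι`. Only its linearity is needed, so it
does not matter whether the augmentation of `𝒞₂ ⊗ 𝒯` is multiplicative. -/
theorem ι_injective : Function.Injective Q.ι := by
  let ρ : Q.IDRModule →ₗ[C] R := TensorProduct.lift
    ((LinearMap.lsmul C R).flip.compl₂ (TensorProduct.lift ((LinearMap.mul C C).compl₁₂
      (SymmetricAlgebra.algebraMapInv : SymmetricAlgebra C (Q.J ⊗[C] Q.Tensors) →ₐ[C] C).toLinearMap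
      (genShuffleAugmentation C Q.T))))
  have hρ : ∀ f, ρ (Q.ι f) = f := fun f => by
    have h : ρ (Q.ι f) =
        ((SymmetricAlgebra.algebraMapInv : SymmetricAlgebra C (Q.J ⊗[C] Q.Tensors) →ₐ[C] C) 1 *
          genShuffleAugmentation C Q.T 1) • f := rfl
    rw [h, map_one, genShuffleAugmentation_one, one_mul, one_smul]
  exact Function.LeftInverse.injective hρ

/-! ### Factoring elements of `IDR(R)` through its three algebra factors -/

/-- The inclusion of `𝒞₁`. -/
def inclConstants₁ : Q.Constants₁ →ₐ[C] Q.IDR :=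
  (Algebra.TensorProduct.includeRight :
    Q.Constants₁ ⊗[C] GenShuffle C Q.T →ₐ[C] Q.IDRModule).comp
    Algebra.TensorProduct.includeLeft

/-- The inclusion of `𝒞₂ ⊗ 𝒯`. -/
def inclGenShuffle : GenShuffle C Q.T →ₐ[C] Q.IDR :=
  (Algebra.TensorProduct.includeRight :
    Q.Constants₁ ⊗[C] GenShuffle C Q.T →ₐ[C] Q.IDRModule).comp
    Algebra.TensorProduct.includeRight

/-- Turns tensors into products of images of algebra homomorphisms, so that identities between
tensors become goals for `ring`. -/
theorem tmul_eq_mul (f₀ : R) (c₁ : Q.Constants₁) (c₂ : Constants₂ C Q.T) (t : Q.Tensors) :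
    Q.tmul f₀ c₁ c₂ t =
      Q.ι f₀ * (Q.inclConstants₁ c₁ * Q.inclGenShuffle (GenShuffle.tmul c₂ t)) := by
  have h : (f₀ ⊗ₜ[C] (c₁ ⊗ₜ[C] GenShuffle.tmul c₂ t) : Q.IDRModule) =
      (f₀ ⊗ₜ[C] 1) * ((1 ⊗ₜ[C] (c₁ ⊗ₜ[C] 1)) * (1 ⊗ₜ[C] (1 ⊗ₜ[C] GenShuffle.tmul c₂ t))) := by
    simp only [Algebra.TensorProduct.tmul_mul_tmul, one_mul, mul_one]
  exact h

theorem hom_ext {N : Type*} [AddCommGroup N] [Module C N] {F G : Q.IDR →ₗ[C] N}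
    (h : ∀ l f₀ c₁ c₂, F (Q.tmul f₀ c₁ c₂ (pureTensor C l)) =
      G (Q.tmul f₀ c₁ c₂ (pureTensor C l))) : F = G :=
  TensorProduct.ext <| LinearMap.ext fun f₀ => TensorProduct.ext <| LinearMap.ext fun c₁ =>
    GenShuffle.hom_ext fun c₂ l => h l f₀ c₁ c₂

/-- Unlike the elements `f₀ ⊗ c₁ ⊗ c₂ ⊗ f` with a pure tensor `f`, these generators are closed under
multiplication, because the last factor is an arbitrary element of `𝒞₂ ⊗ 𝒯`. This suits the proof of
the Leibniz rule. -/
theorem hom_ext_mul {N : Type*} [AddCommGroup N] [Module C N] {F G : Q.IDR →ₗ[C] N}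
    (h : ∀ f₀ c₁ x, F (Q.ι f₀ * (Q.inclConstants₁ c₁ * Q.inclGenShuffle x)) =
      G (Q.ι f₀ * (Q.inclConstants₁ c₁ * Q.inclGenShuffle x))) : F = G :=
  Q.hom_ext fun l f₀ c₁ c₂ => by rw [tmul_eq_mul, h]

/-! ### The Leibniz rule -/

/-- The derivative of elements of `𝒞₂ ⊗ 𝒯`. -/
def genShuffleDeriv : GenShuffle C Q.T →ₗ[C] Q.IDR := Q.deriv ∘ₗ Q.inclGenShuffle.toLinearMap

theorem genShuffleDeriv_tmul (c₂ : Constants₂ C Q.T) (l : List Q.T) :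
    Q.genShuffleDeriv (GenShuffle.tmul c₂ (pureTensor C l)) = Q.derivPure l 1 1 c₂ := by
  rw [← deriv_tmul, tmul_eq_mul, map_one, map_one, one_mul, one_mul]; rfl

theorem inclGenShuffle_smul (c : Constants₂ C Q.T) (x : GenShuffle C Q.T) :
    Q.inclGenShuffle (c • x) = Q.inclGenShuffle (GenShuffle.tmul c 1) * Q.inclGenShuffle x := by
  rw [← map_mul]
  congr 1
  have h : GenShuffle.tmul c 1 = c • (1 : GenShuffle C Q.T) := by
    rw [GenShuffle.one_def, GenShuffle.smul_tmul, mul_one]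
  rw [h, GenShuffle.smul_mul', one_mul]

theorem tmul_eq_smul_pure (c : Constants₂ C Q.T) (l : List Q.T) :
    GenShuffle.tmul c (pureTensor C l) = c • GenShuffle.pure l := by
  rw [GenShuffle.pure, GenShuffle.smul_tmul, mul_one]

/-- Elements of `𝒞₂` behave as constants, since differentiating a pure tensor leaves its coefficient
in `𝒞₂` untouched. -/
theorem genShuffleDeriv_smul (c : Constants₂ C Q.T) (x : GenShuffle C Q.T) :
    Q.genShuffleDeriv (c • x) =
      Q.inclGenShuffle (GenShuffle.tmul c 1) * Q.genShuffleDeriv x := by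
  refine GenShuffle.ext_pure x (p := fun x => Q.genShuffleDeriv (c • x) =
      Q.inclGenShuffle (GenShuffle.tmul c 1) * Q.genShuffleDeriv x) ?_ ?_ ?_
  · simp only [smul_zero, map_zero, mul_zero]
  · intro x y hx hy
    simp only [smul_add, map_add, hx, hy, mul_add]
  · intro d l
    rw [smul_smul, ← tmul_eq_smul_pure, ← tmul_eq_smul_pure, genShuffleDeriv_tmul,
      genShuffleDeriv_tmul]
    cases l with
    | nil =>
      simp only [derivPure, tmul_eq_mul, ← GenShuffle.smul_tmul, inclGenShuffle_smul]
      ring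
    | cons a l =>
      simp only [derivPure, tmul_eq_mul, ← GenShuffle.smul_tmul, inclGenShuffle_smul]
      ring

theorem genShuffleDeriv_one : Q.genShuffleDeriv 1 = 0 := by
  have h := Q.genShuffleDeriv_tmul 1 []
  simpa only [pureTensor_nil, ← GenShuffle.one_def, derivPure, Derivation.map_one_eq_zero,
    tmul_eq_mul, map_zero, zero_mul] using h

/-- Prepending `a` is the formal integral `∫ a x`, and this is the fundamental theorem of calculus
for it. The coefficient in `R` is `1`, so only the term that removes `a` survives. -/
theorem genShuffleDeriv_consHom (a : Q.T) (x : GenShuffle C Q.T) :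
    Q.genShuffleDeriv (GenShuffle.consHom a x) = Q.ι a * Q.inclGenShuffle x := by
  refine GenShuffle.ext_pure x (p := fun x => Q.genShuffleDeriv (GenShuffle.consHom a x) =
      Q.ι a * Q.inclGenShuffle x) ?_ ?_ ?_
  · simp only [map_zero, mul_zero]
  · intro x y hx hy
    simp only [map_add, hx, hy, mul_add]
  · intro c l
    rw [map_smul, GenShuffle.consHom_pure, ← tmul_eq_smul_pure, ← tmul_eq_smul_pure,
      genShuffleDeriv_tmul]
    simp only [derivPure, Derivation.map_one_eq_zero, tmul_eq_mul, map_zero, zero_mul, zero_add,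
      one_mul, map_one]

/-- By linearity over `𝒞₂` both factors may be taken to be pure tensors. For nonempty ones the
recursion `pure_cons_mul` is differentiated once; no induction is needed, because the derivative
leaves the inner products as they are. -/
theorem genShuffleDeriv_mul (x y : GenShuffle C Q.T) :
    Q.genShuffleDeriv (x * y) =
      Q.inclGenShuffle x * Q.genShuffleDeriv y + Q.inclGenShuffle y * Q.genShuffleDeriv x := by
  refine GenShuffle.ext_pure x (p := fun x => Q.genShuffleDeriv (x * y) =
      Q.inclGenShuffle x * Q.genShuffleDeriv y + Q.inclGenShuffle y * Q.genShuffleDeriv x)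
    ?_ ?_ ?_
  · simp only [map_zero, mul_zero, zero_mul, add_zero]
  · intro x x' hx hx'
    simp only [map_add, hx, hx', mul_add, add_mul]; abel
  intro c f
  simp only [GenShuffle.smul_mul', genShuffleDeriv_smul, inclGenShuffle_smul]
  refine GenShuffle.ext_pure y (p := fun y => Q.inclGenShuffle (GenShuffle.tmul c 1) *
      Q.genShuffleDeriv (GenShuffle.pure f * y) =
      Q.inclGenShuffle (GenShuffle.tmul c 1) * Q.inclGenShuffle (GenShuffle.pure f) *
        Q.genShuffleDeriv y + Q.inclGenShuffle y *
        (Q.inclGenShuffle (GenShuffle.tmul c 1) * Q.genShuffleDeriv (GenShuffle.pure f)))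
    ?_ ?_ ?_
  · simp only [map_zero, mul_zero, zero_mul, add_zero]
  · intro x x' hx hx'
    simp only [map_add, hx, hx', mul_add, add_mul]; abel
  intro d g
  simp only [GenShuffle.mul_smul', genShuffleDeriv_smul, inclGenShuffle_smul]
  suffices h : Q.genShuffleDeriv (GenShuffle.pure f * GenShuffle.pure g) =
      Q.inclGenShuffle (GenShuffle.pure f) * Q.genShuffleDeriv (GenShuffle.pure g) +
      Q.inclGenShuffle (GenShuffle.pure g) * Q.genShuffleDeriv (GenShuffle.pure f) by
    rw [h]; ring
  match f, g with
  | [], g => rw [GenShuffle.pure_nil, genShuffleDeriv_one, map_one, one_mul, one_mul, mul_zero,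
      add_zero]
  | f, [] => rw [GenShuffle.pure_nil, genShuffleDeriv_one, map_one, mul_one, one_mul, mul_zero,
      zero_add]
  | a :: f, b :: g =>
    -- The two prepended terms become `a · (f · (b ⊗ g))` and `b · ((a ⊗ f) · g)`, while the `ε`
    -- term is a multiple of `1` and vanishes. On the right side the pure tensors are rewritten with
    -- `consHom` so that their derivatives take the same form.
    rw [GenShuffle.pure_cons_mul, map_add, map_add, genShuffleDeriv_consHom,
      genShuffleDeriv_consHom, genShuffleDeriv_smul, genShuffleDeriv_one,
      ← GenShuffle.consHom_pure a, ← GenShuffle.consHom_pure b, genShuffleDeriv_consHom,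
      genShuffleDeriv_consHom, map_mul, map_mul]
    ring

theorem deriv_mul_mul (f₀ : R) (c₁ : Q.Constants₁) (x : GenShuffle C Q.T) :
    Q.deriv (Q.ι f₀ * (Q.inclConstants₁ c₁ * Q.inclGenShuffle x)) =
      Q.ι (D f₀) * (Q.inclConstants₁ c₁ * Q.inclGenShuffle x) +
        Q.ι f₀ * Q.inclConstants₁ c₁ * Q.genShuffleDeriv x := by
  refine GenShuffle.ext_pure x (p := fun x =>
      Q.deriv (Q.ι f₀ * (Q.inclConstants₁ c₁ * Q.inclGenShuffle x)) =
      Q.ι (D f₀) * (Q.inclConstants₁ c₁ * Q.inclGenShuffle x) +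
        Q.ι f₀ * Q.inclConstants₁ c₁ * Q.genShuffleDeriv x) ?_ ?_ ?_
  · simp only [map_zero, mul_zero, add_zero]
  · intro x y hx hy
    simp only [map_add, hx, hy, mul_add]; abel
  · intro c l
    rw [← tmul_eq_smul_pure, ← tmul_eq_mul, deriv_tmul, genShuffleDeriv_tmul]
    cases l with
    | nil =>
      simp only [derivPure, tmul_eq_mul, Derivation.map_one_eq_zero, map_zero, zero_mul, mul_zero,
        add_zero, pureTensor_nil]
    | cons a l =>
      simp only [derivPure, tmul_eq_mul, Derivation.map_one_eq_zero, map_zero, zero_mul, map_mul,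
        map_one]
      ring

theorem deriv_mul (x y : Q.IDR) : Q.deriv (x * y) = x * Q.deriv y + y * Q.deriv x := by
  -- The rule is an equality of bilinear maps, so it can be checked on generators in each variable.
  suffices h : (LinearMap.mul C Q.IDR).compr₂ Q.deriv =
      (LinearMap.mul C Q.IDR).compl₂ Q.deriv +
        ((LinearMap.mul C Q.IDR).compl₂ Q.deriv).flip from congr($h x y)
  refine Q.hom_ext_mul fun f₀ c₁ x => Q.hom_ext_mul fun g₀ d₁ y => ?_
  simp only [LinearMap.compr₂_apply, LinearMap.compl₂_apply, LinearMap.add_apply,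
    LinearMap.flip_apply, LinearMap.mul_apply']
  have h : Q.ι f₀ * (Q.inclConstants₁ c₁ * Q.inclGenShuffle x) *
      (Q.ι g₀ * (Q.inclConstants₁ d₁ * Q.inclGenShuffle y)) =
      Q.ι (f₀ * g₀) * (Q.inclConstants₁ (c₁ * d₁) * Q.inclGenShuffle (x * y)) := by
    simp only [map_mul]; ring
  rw [h, deriv_mul_mul, deriv_mul_mul, deriv_mul_mul, genShuffleDeriv_mul]
  simp only [Derivation.leibniz, smul_eq_mul, map_add, map_mul]
  ring

/-- The derivation on `IDR(R)`. -/
def derivation : Derivation ℤ Q.IDR Q.IDR :=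
  Derivation.mk' (Q.deriv.toAddMonoidHom.toIntLinearMap) fun x y => Q.deriv_mul x y

theorem derivation_apply (x : Q.IDR) : Q.derivation x = Q.deriv x := rfl

/-! ### The integration is a right inverse of the derivation -/

theorem deriv_tmul_one (c₁ : Q.Constants₁) (c₂ : Constants₂ C Q.T) :
    Q.deriv (Q.tmul 1 c₁ c₂ 1) = 0 := by
  have h := Q.deriv_tmul [] 1 c₁ c₂
  rw [pureTensor_nil] at h
  rw [h, derivPure, Derivation.map_one_eq_zero, tmul_eq_mul, map_zero, zero_mul]

theorem deriv_ι (f : R) : Q.deriv (Q.ι f) = Q.ι (D f) :=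
  Q.deriv_tmul [] f 1 1

/-- The terms with coefficients `Q f₀` and `1` differentiate to `∂Qf₀` and `f₀ - ∂Qf₀`, which add up
to `f₀`. The induction must vary `f₀`, as the recursive integral has coefficient `Q f₀ * f₁`. -/
theorem deriv_intPure (l : List Q.T) (f₀ : R) (c₁ : Q.Constants₁) (c₂ : Constants₂ C Q.T) :
    Q.deriv (Q.intPure l f₀ c₁ c₂) = Q.tmul f₀ c₁ c₂ (pureTensor C l) := by
  have hsplit : ∀ (f : R) (t : Q.Tensors), Q.tmul (D (Q f)) c₁ c₂ t +
      Q.tmul ((Q.rest f : Q.T) : R) c₁ c₂ t = Q.tmul f c₁ c₂ t := fun f t => by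
    rw [← tmul_add₀]
    congr 1
    exact add_sub_cancel (D (Q f)) f
  have hzero : ∀ t : Q.Tensors, Q.tmul 0 c₁ c₂ t = 0 := fun t => by
    rw [tmul_eq_mul, map_zero, zero_mul]
  induction l generalizing f₀ with
  | nil =>
    have h := Q.deriv_tmul [] (Q f₀) c₁ c₂
    rw [pureTensor_nil] at h
    rw [intPure, map_add, map_sub, h, deriv_tmul_one, deriv_tmul, derivPure, derivPure,
      Derivation.map_one_eq_zero, hzero, one_mul, pureTensor_nil, sub_zero, zero_add, hsplit]
  | cons a l ih =>
    -- By `ih`, the recursive integral contributes exactly the term with coefficient `Q f₀ * a` that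
    -- arises, with opposite sign, from removing `a` in the first summand.
    rw [intPure, map_add, map_sub, map_sub, ih, deriv_tmul, deriv_tmul_one, deriv_tmul, derivPure,
      derivPure, Derivation.map_one_eq_zero, hzero, one_mul, sub_zero, zero_add, ← hsplit f₀]
    abel

theorem deriv_int (x : Q.IDR) : Q.deriv (Q.int x) = x := by
  suffices h : Q.deriv ∘ₗ Q.int = LinearMap.id from congr($h x)
  refine Q.hom_ext fun l f₀ c₁ c₂ => ?_
  rw [LinearMap.comp_apply, int_tmul, deriv_intPure, LinearMap.id_apply]

/-! ### Linearity of the integration over the span of the evident constants -/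

theorem tmul_one_mul_tmul (c₁ d₁ : Q.Constants₁) (c₂ d₂ : Constants₂ C Q.T) (f₀ : R)
    (t : Q.Tensors) :
    Q.tmul 1 c₁ c₂ 1 * Q.tmul f₀ d₁ d₂ t = Q.tmul f₀ (c₁ * d₁) (c₂ * d₂) t := by
  rw [tmul_eq_mul, tmul_eq_mul, tmul_eq_mul, ← GenShuffle.smul_tmul, inclGenShuffle_smul,
    map_one, map_mul]
  ring

/-- The recursion for `∫` only ever multiplies the coefficient in `𝒞₁` by some `ε(…)` and never
changes the one in `𝒞₂`, so common factors pull out. -/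
theorem intPure_mul (l : List Q.T) (f₀ : R) (c₁ d₁ : Q.Constants₁) (c₂ d₂ : Constants₂ C Q.T) :
    Q.intPure l f₀ (c₁ * d₁) (c₂ * d₂) = Q.tmul 1 c₁ c₂ 1 * Q.intPure l f₀ d₁ d₂ := by
  induction l generalizing f₀ with
  | nil => simp only [intPure, mul_add, mul_sub, tmul_one_mul_tmul, mul_assoc]
  | cons a l ih => simp only [intPure, mul_add, mul_sub, tmul_one_mul_tmul, mul_assoc, ih]

theorem int_tmul_one_mul (c₁ : Q.Constants₁) (c₂ : Constants₂ C Q.T) (x : Q.IDR) :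
    Q.int (Q.tmul 1 c₁ c₂ 1 * x) = Q.tmul 1 c₁ c₂ 1 * Q.int x := by
  suffices h : Q.int ∘ₗ LinearMap.mulLeft C (Q.tmul 1 c₁ c₂ 1) =
      LinearMap.mulLeft C (Q.tmul 1 c₁ c₂ 1) ∘ₗ Q.int from congr($h x)
  refine Q.hom_ext fun l f₀ d₁ d₂ => ?_
  simp only [LinearMap.comp_apply, LinearMap.mulLeft_apply, tmul_one_mul_tmul, int_tmul,
    intPure_mul]

/-- The span of the elements `1 ⊗ c₁ ⊗ c₂ ⊗ 1`. -/
def constantSpan : Submodule C Q.IDR :=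
  Submodule.span C (Set.range fun c : Q.Constants₁ × Constants₂ C Q.T => Q.tmul 1 c.1 c.2 1)

theorem tmul_mem_constantSpan (c₁ : Q.Constants₁) (c₂ : Constants₂ C Q.T) :
    Q.tmul 1 c₁ c₂ 1 ∈ Q.constantSpan :=
  Submodule.subset_span ⟨(c₁, c₂), rfl⟩

theorem int_mul_of_mem_constantSpan {c : Q.IDR} (hc : c ∈ Q.constantSpan) (x : Q.IDR) :
    Q.int (c * x) = c * Q.int x := by
  induction hc using Submodule.span_induction with
  | mem c h => obtain ⟨⟨c₁, c₂⟩, rfl⟩ := h; exact Q.int_tmul_one_mul c₁ c₂ x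
  | zero => rw [zero_mul, zero_mul, map_zero]
  | add c d _ _ hc hd => rw [add_mul, add_mul, map_add, hc, hd]
  | smul r c _ hc => rw [smul_mul_assoc, smul_mul_assoc, map_smul, hc]

/-! ### Integrals with integrand in `R_T`, and the constants of `IDR(R)` -/

theorem rest_coe (a : Q.T) : Q.rest (a : R) = a := by
  have ha : Q (a : R) = 0 := LinearMap.mem_ker.mp a.2
  apply Subtype.ext
  change (a : R) - D (Q (a : R)) = a
  rw [ha, map_zero, sub_zero]

/-- Since `Q a = 0`, every summand of the integral vanishes except the last, where `a - ∂Qa = a` is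
prepended. -/
theorem intPure_coe (a : Q.T) (l : List Q.T) (c₁ : Q.Constants₁) (c₂ : Constants₂ C Q.T) :
    Q.intPure l (a : R) c₁ c₂ = Q.tmul 1 c₁ c₂ (pureTensor C (a :: l)) := by
  have ha : Q (a : R) = 0 := LinearMap.mem_ker.mp a.2
  have ha' : Q.quasi (a : R) = 0 := Subtype.ext ha
  -- This disposes of the recursive integral, whose coefficient `Q a * f₁` is zero.
  have h0 : ∀ (l : List Q.T), Q.intPure l 0 c₁ c₂ = 0 := fun l => by
    have := Q.intPure_smul₀ l 0 0 c₁ c₂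
    rwa [zero_smul, zero_smul] at this
  cases l <;> simp only [intPure, ha, ha', rest_coe, TensorProduct.zero_tmul, map_zero, mul_zero,
    zero_mul, h0] <;> simp only [tmul_eq_mul, map_zero, zero_mul, mul_zero, sub_zero, zero_add]

/-- In `∫∂(f₀ ⊗ c ⊗ f)` the part of `f₀` outside the image of `Q` is the constant `r = f₀ - Q∂f₀`.
For nonempty `f` the two remaining integrals differ by `r` times the integral of an element of
`R_T`, which restores `r ⊗ c ⊗ f`. Thus everything cancels but the `ε` term, or for empty `f` the
`ε` term and `r` itself. -/
theorem sub_int_deriv_mem (hC : ∀ f : R, D f = 0 → ∃ c : C, algebraMap C R c = f) (x : Q.IDR) :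
    x - Q.int (Q.deriv x) ∈ Q.constantSpan := by
  -- Membership becomes the vanishing of a linear map into the quotient, which can be tested on pure
  -- tensors.
  suffices h : Q.constantSpan.mkQ ∘ₗ (LinearMap.id - Q.int ∘ₗ Q.deriv) = 0 from
    (Submodule.Quotient.mk_eq_zero _).mp congr($h x)
  refine Q.hom_ext fun l f₀ c₁ c₂ => (Submodule.Quotient.mk_eq_zero _).mpr ?_
  -- `∂Q∂ = ∂` makes `f₀ - Q∂f₀` a constant. This is where `C` must contain all constants of `R`.
  obtain ⟨r, hr⟩ := hC (f₀ - Q (D f₀)) (by rw [map_sub, Q.deriv_quasi_deriv, sub_self])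
  have hf : f₀ = Q (D f₀) + r • (1 : R) := by
    rw [← Algebra.algebraMap_eq_smul_one, hr]; abel
  have hrest : Q.rest (D f₀) = 0 := Subtype.ext (by
    change D f₀ - D (Q (D f₀)) = 0
    rw [Q.deriv_quasi_deriv, sub_self])
  have htzero : Q.tmul 1 c₁ c₂ 0 = 0 := by
    have := Q.tmul_smul₃ 0 1 c₁ c₂ 0
    rwa [zero_smul, zero_smul] at this
  rw [LinearMap.sub_apply, LinearMap.id_apply, LinearMap.comp_apply, deriv_tmul]
  cases l with
  | nil =>
    have hint := Q.int_tmul [] (D f₀) c₁ c₂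
    rw [pureTensor_nil] at hint
    have : Q.tmul f₀ c₁ c₂ (pureTensor C []) - Q.int (Q.derivPure [] f₀ c₁ c₂) =
        r • Q.tmul 1 c₁ c₂ 1 +
          Q.tmul 1 (c₁ * Q.eps₁ (Q.quasi (D f₀) ⊗ₜ 1)) c₂ 1 := by
      rw [derivPure, hint, intPure, hrest, pureTensor_cons, map_zero, zero_mul, htzero,
        pureTensor_nil, ← tmul_smul₀]
      -- Only the leading coefficient is decomposed; the other occurrences of `f₀` are inside `Q (D
      -- f₀)`.
      nth_rewrite 1 [hf]
      rw [tmul_add₀]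
      abel
    rw [this]
    exact Submodule.add_mem _ (Submodule.smul_mem _ _ (Q.tmul_mem_constantSpan _ _))
      (Q.tmul_mem_constantSpan _ _)
  | cons a l =>
    have : Q.tmul f₀ c₁ c₂ (pureTensor C (a :: l)) - Q.int (Q.derivPure (a :: l) f₀ c₁ c₂) =
        Q.tmul 1 (c₁ * Q.eps₁ (Q.quasi (D f₀) ⊗ₜ pureTensor C (a :: l))) c₂ 1 := by
      have h1 : f₀ * (a : R) = Q (D f₀) * a + r • (a : R) := by
        nth_rewrite 1 [hf]
        rw [add_mul, smul_mul_assoc, one_mul]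
      rw [derivPure, map_add, int_tmul, int_tmul, intPure, hrest, pureTensor_cons (0 : Q.T),
        map_zero, zero_mul, htzero, h1, intPure_add₀, intPure_smul₀, intPure_coe, ← tmul_smul₀]
      nth_rewrite 1 [hf]
      rw [tmul_add₀]
      abel
    rw [this]
    exact Q.tmul_mem_constantSpan _ _

theorem mem_constantSpan_of_deriv_eq_zero
    (hC : ∀ f : R, D f = 0 → ∃ c : C, algebraMap C R c = f) {x : Q.IDR} (hx : Q.deriv x = 0) :
    x ∈ Q.constantSpan := by
  simpa only [hx, map_zero, sub_zero] using Q.sub_int_deriv_mem hC x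

/-- Each integration prepends one factor by `intPure_coe`. The empty list is a harmless base case,
as both sides are then `1`. -/
theorem nestedIntegral_map_ι (f : List Q.T) :
    nestedIntegral Q.int (f.map fun a : Q.T => Q.ι (a : R)) =
      Q.tmul 1 1 1 (pureTensor C f) := by
  induction f with
  | nil => exact (map_one Q.ι).symm
  | cons a f ih =>
    rw [List.map_cons, nestedIntegral, ih, ← intPure_coe, ← int_tmul]
    congr 1
    simp only [tmul_eq_mul, map_one, one_mul]

end QuasiIntegration

end IntDiff
end

/-! ### The main theorem -/

theorem theorem3 {R : Type*} [CommRing R] (D : Derivation ℤ R R)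
    (Q : IntDiff.QuasiIntegration (IntDiff.overConstants D)) :
    ∃ d : Derivation ℤ Q.IDR Q.IDR,
      (∀ x, d x = Q.deriv x) ∧
      IntDiff.IsIntegration d Q.int ∧
      Function.Injective Q.ι ∧
      (∀ f : R, d (Q.ι f) = Q.ι (D f)) ∧
      ∀ (f₀ : R) (f : List Q.T), f ≠ [] →
        Q.ι f₀ * IntDiff.nestedIntegral Q.int (f.map fun a : Q.T => Q.ι (a : R)) =
          Q.tmul f₀ 1 1 (IntDiff.pureTensor (IntDiff.constants D) f) := by
  refine ⟨Q.derivation, Q.derivation_apply, ⟨map_add Q.int, fun c hc f => ?_, Q.deriv_int⟩,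
    Q.ι_injective, Q.deriv_ι, fun f₀ f _ => ?_⟩
  -- The base ring is the kernel of `D` itself, so every constant of `R` comes from it by
  -- definition.
  · exact Q.int_mul_of_mem_constantSpan
      (Q.mem_constantSpan_of_deriv_eq_zero (fun f hf => ⟨⟨f, hf⟩, rfl⟩) hc) f
  · rw [Q.nestedIntegral_map_ι, Q.tmul_eq_mul f₀, Q.tmul_eq_mul 1]
    simp only [map_one, one_mul]
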